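/- Let $p$ be a prime number, let $t>0$ and let $\lambda=(t,t,0,\dots,0)\in\mathbb R^p$. Let $\mathcal O_\lambda$ be the set of Hermitian $p\times p$ matrices with spectrum $\lambda$, that is, the orbit of $\mathrm{diag}(\lambda)$ under conjugation by $U(p)$, so that $\mathcal O_\lambda\cong\mathrm{Gr}(2,p)$. Equip it with the Kirillov–Kostant–Souriau form $\omega_h([X,h],[Y,h])=\mathrm{tr}(i\,h[X,Y])$, where $X,Y$ are skew-Hermitian. Let $\Phi_\lambda=(\Phi_\lambda^{i,j})_{i,j\ge1,\ i+j\le p+1}$ be the Gelfand–Cetlin system, where $\Phi_\lambda^{i,j}(x)$ is the $i$-th largest eigenvalue of the leading principal $(i+j-1)\times(i+j-1)$ submatrix of $x$, and let $\Delta_\lambda$ be the Gelfand–Cetlin polytope of all $(u_{i,j})$ with $u_{i,j+1}\ge u_{i,j}\ge u_{i+1,j}$ and $u_{i,p+1-i}=\lambda_i$. A subset $Y\subset\mathcal O_\lambda$ is displaceable if $\phi(Y)\cap\overline{Y}=\emptyset$ for some Hamiltonian diffeomorphism $\phi$ of $(\mathcal O_\lambda,\omega_\lambda)$. A face $f$ of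 $\Delta_\lambda$, with relative interior $\mathring f$, is Lagrangian if $\Phi_\lambda^{-1}(u)$ is a Lagrangian submanifold for some $u\in\mathring f$, and proper if $f\ne\Delta_\lambda$. A permutation $w$ of $\{1,\dots,p\}$ acts on $\mathcal O_\lambda$ by conjugation with its permutation matrix: $(w\cdot x)_{ij}=x_{w(i)w(j)}$. 1. Every Lagrangian fiber $\Phi_\lambda^{-1}(u)$, $u\in\Delta_\lambda$, which is not homeomorphic to a torus is displaceable. 2. For every proper Lagrangian face $f$ of $\Delta_\lambda$, the fiber $\Phi_\lambda^{-1}(u)$ is displaceable for every $u\in\mathring f$. Moreover there is a permutation $w$ whose action on $\mathcal O_\lambda$ is a Hamiltonian diffeomorphism and satisfies $w\cdot\Phi_\lambda^{-1}(\mathring f)\cap\Phi_\lambda^{-1}(\mathring f)=\emptyset$. 3. Let $r\ge1$ and let $2\le i_1<\dots<i_r\le p-2$ with $i_{s+1}-i_s\ge2$ for all $s$, and let $\gamma_{i_1,\dots,i_r}$ be the face of $\Delta_\lambda$ given by $u_{1,i_s}=u_{1,i_s-1}=u_{2,i_s}=u_{2,i_s-1}$ for $s=1,\dots,r$. Then there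 is a permutation $w$ whose action on $\mathcal O_\lambda$ is a Hamiltonian diffeomorphism and satisfies $w\cdot\Phi_\lambda^{-1}(\mathring\gamma_{i_1,\dots,i_r})\cap\Phi_\lambda^{-1}(\mathring\gamma_{i_1,\dots,i_r})=\emptyset$. -/

import Mathlib

open scoped ContDiff Matrix.Norms.Operator

namespace GelfandCetlin

/-- Complex `n × n` matrices. They carry the operator norm for the sup norm on `ℂⁿ`; only the
topology and the smooth structure of this finite-dimensional real vector space are used. -/
abbrev Mat (n : ℕ) : Type := Matrix (Fin n) (Fin n) ℂ

/-! ### Coadjoint orbits of the unitary group -/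

/-- The orbit `𝒪_λ` of `diag(λ₁, …, λₙ)` under conjugation by unitary matrices. -/
def orbit {n : ℕ} (lam : Fin n → ℝ) : Set (Mat n) :=
  {x | ∃ U ∈ Matrix.unitaryGroup (Fin n) ℂ,
    x = U * Matrix.diagonal (fun i => (lam i : ℂ)) * star U}

theorem orbit_isHermitian {n : ℕ} {lam : Fin n → ℝ} (x : orbit lam) :
    (x : Mat n).IsHermitian := by
  obtain ⟨x, U, hU, rfl⟩ := x
  have h : (Matrix.diagonal (fun i => (lam i : ℂ))).IsHermitian := by
    rw [Matrix.isHermitian_diagonal_iff]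
    intro i
    simp [isSelfAdjoint_iff]
  exact Matrix.isHermitian_mul_mul_conjTranspose U h

/-- The action of the unitary group on `𝒪_λ` by conjugation. -/
def unitaryAct {n : ℕ} {lam : Fin n → ℝ} (U : Matrix.unitaryGroup (Fin n) ℂ)
    (x : orbit lam) : orbit lam :=
  ⟨(U : Mat n) * x * star (U : Mat n), by
    obtain ⟨x, V, hV, rfl⟩ := x
    exact ⟨U * V, mul_mem U.2 hV, by simp only [star_mul, mul_assoc]⟩⟩

theorem permMatrix_mem_unitaryGroup {n : ℕ} (w : Equiv.Perm (Fin n)) :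
    w.permMatrix ℂ ∈ Matrix.unitaryGroup (Fin n) ℂ := by
  rw [Matrix.mem_unitaryGroup_iff, Matrix.star_eq_conjTranspose,
    Matrix.conjTranspose_permMatrix, ← Matrix.permMatrix_mul]
  simp

/-- The action of a permutation on `𝒪_λ` through its permutation matrix: the `(i, j)` entry of
`w · x` is `x (w i) (w j)`. -/
def permAct {n : ℕ} {lam : Fin n → ℝ} (w : Equiv.Perm (Fin n)) (x : orbit lam) : orbit lam :=
  unitaryAct ⟨w.permMatrix ℂ, permMatrix_mem_unitaryGroup w⟩ x

/-! ### The Kirillov–Kostant–Souriau form and Hamiltonian diffeomorphisms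

The tangent space of the orbit at `h` consists of the brackets `⁅X, h⁆`, with `X` skew-Hermitian,
and the symplectic form is `ω_h(⁅X, h⁆, ⁅Y, h⁆) = tr(i h ⁅X, Y⁆)`. -/

/-- The value `ω_h(⁅X, h⁆, ⁅Y, h⁆) = tr(i h ⁅X, Y⁆)` (a real number when `h` is Hermitian and
`X`, `Y` are skew-Hermitian) of the Kirillov–Kostant–Souriau form. -/
noncomputable def kks {n : ℕ} (h X Y : Mat n) : ℝ :=
  (Matrix.trace (Complex.I • (h * ⁅X, Y⁆))).re

/-- `kks` depends only on the tangent vectors `⁅X, h⁆` and `⁅Y, h⁆`. -/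
theorem kks_congr {n : ℕ} {h X X' Y Y' : Mat n} (hX : ⁅X, h⁆ = ⁅X', h⁆)
    (hY : ⁅Y, h⁆ = ⁅Y', h⁆) : kks h X Y = kks h X' Y' := by
  have e₁ : ∀ A B : Mat n, Matrix.trace (h * ⁅A, B⁆) = -Matrix.trace (B * ⁅A, h⁆) := by
    intro A B
    simp only [Ring.lie_def, mul_sub, Matrix.trace_sub, ← mul_assoc]
    rw [Matrix.trace_mul_cycle h A B, Matrix.trace_mul_cycle h B A,
      Matrix.trace_mul_cycle A h B]
    ring
  have e₂ : ∀ A B : Mat n, Matrix.trace (h * ⁅A, B⁆) = Matrix.trace (A * ⁅B, h⁆) := by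
    intro A B
    have hs : ⁅A, B⁆ = -⁅B, A⁆ := by simp only [Ring.lie_def, neg_sub]
    rw [hs, mul_neg, Matrix.trace_neg, e₁ B A, neg_neg]
  simp only [kks, Matrix.trace_smul]
  rw [e₁ X Y, hX, ← e₁ X' Y, e₂ X' Y, hY, ← e₂ X' Y']

/-- `φ` is a Hamiltonian diffeomorphism of `(𝒪_λ, ω_λ)`: the time-one map of the flow of a smooth
time-dependent Hamiltonian `H`. As `𝒪_λ` is a compact submanifold of the space of matrices, smooth
functions on `𝒪_λ` are the restrictions of smooth functions of the matrix. The velocity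
`⁅X, F s x⁆` of the flow line through `x` satisfies `ω(⁅X, F s x⁆, ·) = d H_s` on the tangent
space of the orbit. -/
def IsHamiltonianDiffeo {n : ℕ} {lam : Fin n → ℝ} (φ : orbit lam → orbit lam) : Prop :=
  ∃ (H : ℝ → Mat n → ℝ) (F : ℝ → orbit lam → orbit lam),
    ContDiff ℝ ∞ (fun q : ℝ × Mat n => H q.1 q.2) ∧
    (∀ x, F 0 x = x) ∧ (∀ x, F 1 x = φ x) ∧
    ∀ s ∈ Set.Icc (0 : ℝ) 1, ∀ x : orbit lam, ∃ X : Mat n, star X = -X ∧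
      HasDerivWithinAt (fun r => (F r x : Mat n)) ⁅X, (F s x : Mat n)⁆ (Set.Icc 0 1) s ∧
      ∀ Y : Mat n, star Y = -Y →
        kks (F s x) X Y = fderiv ℝ (H s) (F s x) ⁅Y, (F s x : Mat n)⁆

/-- `Y` is displaceable: some Hamiltonian diffeomorphism `φ` satisfies `φ(Y) ∩ closure Y = ∅`. -/
def IsDisplaceable {n : ℕ} {lam : Fin n → ℝ} (Y : Set (orbit lam)) : Prop :=
  ∃ φ : orbit lam → orbit lam, IsHamiltonianDiffeo φ ∧ Disjoint (φ '' Y) (closure Y)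

/-! ### Lagrangian submanifolds and tori -/

/-- `S` is a smooth embedded submanifold of `E` (without boundary): around each of its points there
is a smooth chart of `E` in which `S` becomes a linear subspace `W`. -/
def IsEmbeddedSubmanifold {E : Type*} [NormedAddCommGroup E] [NormedSpace ℝ E]
    (S : Set E) : Prop :=
  ∀ x ∈ S, ∃ (e : OpenPartialHomeomorph E E) (W : Submodule ℝ E),
    x ∈ e.source ∧ ContDiffOn ℝ ∞ e e.source ∧ ContDiffOn ℝ ∞ e.symm e.target ∧
    e '' (S ∩ e.source) = (W : Set E) ∩ e.target

/-- The tangent vectors of `S` at `x`: the velocities at `x` of the smooth curves in `S`. -/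
def tangentVectors {E : Type*} [NormedAddCommGroup E] [NormedSpace ℝ E]
    (S : Set E) (x : E) : Set E :=
  {v | ∃ c : ℝ → E, ContDiff ℝ ∞ c ∧ (∀ s, c s ∈ S) ∧ c 0 = x ∧ HasDerivAt c v 0}

/-- `Y` is a Lagrangian submanifold of `(𝒪_λ, ω_λ)`: an embedded submanifold whose tangent space
at each point is equal to its own orthogonal for the symplectic form in the tangent space of
`𝒪_λ` (equivalently, `ω_λ` vanishes on `Y` and `Y` has half the dimension of `𝒪_λ`). -/
def IsLagrangian {n : ℕ} {lam : Fin n → ℝ} (Y : Set (orbit lam)) : Prop :=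
  IsEmbeddedSubmanifold (Subtype.val '' Y : Set (Mat n)) ∧
  ∀ x ∈ Y, ∀ A : Mat n, star A = -A →
    (⁅A, (x : Mat n)⁆ ∈ tangentVectors (Subtype.val '' Y : Set (Mat n)) (x : Mat n) ↔
      ∀ B : Mat n, star B = -B →
        ⁅B, (x : Mat n)⁆ ∈ tangentVectors (Subtype.val '' Y : Set (Mat n)) (x : Mat n) →
        kks x A B = 0)

/-- The space `Y` is a torus `(S¹)ᵈ` for some `d ≥ 0`. -/
def IsTorus {α : Type*} [TopologicalSpace α] (Y : Set α) : Prop :=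
  ∃ d : ℕ, Nonempty (Y ≃ₜ (Fin d → Circle))

/-! ### The Gelfand–Cetlin system and its polytope -/

/-- The pairs `(i, j)` of positive integers with `i + j ≤ n + 1`. -/
abbrev Index (n : ℕ) : Type := {q : ℕ × ℕ // 1 ≤ q.1 ∧ 1 ≤ q.2 ∧ q.1 + q.2 ≤ n + 1}

/-- The Gelfand–Cetlin system: its `(i, j)` component at `x` is the `i`-th largest eigenvalue of
the leading principal `(i + j - 1) × (i + j - 1)` submatrix of `x`. (`eigenvalues₀` lists the
eigenvalues with multiplicities in non-increasing order, starting from the index `0`.) -/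
noncomputable def gcMap {n : ℕ} {lam : Fin n → ℝ} (x : orbit lam) : Index n → ℝ := fun q =>
  have hm : q.1.1 + q.1.2 - 1 ≤ n := by have := q.2; omega
  ((orbit_isHermitian x).submatrix (Fin.castLE hm)).eigenvalues₀
    ⟨q.1.1 - 1, by have := q.2; rw [Fintype.card_fin]; omega⟩

/-- The Gelfand–Cetlin polytope: the arrays with `u_{i,j+1} ≥ u_{i,j} ≥ u_{i+1,j}` and
`u_{i,n+1-i} = λ_i`. -/
def gcPolytope {n : ℕ} (lam : Fin n → ℝ) : Set (Index n → ℝ) :=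
  {u | (∀ (q : Index n) (i : Fin n), q.1.1 + q.1.2 = n + 1 → q.1.1 = (i : ℕ) + 1 → u q = lam i) ∧
    (∀ q q' : Index n, q'.1.1 = q.1.1 → q'.1.2 = q.1.2 + 1 → u q ≤ u q') ∧
    (∀ q q' : Index n, q'.1.1 = q.1.1 + 1 → q'.1.2 = q.1.2 → u q' ≤ u q)}

/-- The fiber of the Gelfand–Cetlin system over `u`. -/
def gcFiber {n : ℕ} (lam : Fin n → ℝ) (u : Index n → ℝ) : Set (orbit lam) :=
  {x | gcMap x = u}

/-- `f` is a (nonempty) face of the Gelfand–Cetlin polytope other than the polytope itself. -/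
def IsProperFace {n : ℕ} (lam : Fin n → ℝ) (f : Set (Index n → ℝ)) : Prop :=
  f.Nonempty ∧ IsExposed ℝ (gcPolytope lam) f ∧ f ≠ gcPolytope lam

/-- A face is Lagrangian if the fiber over some point of its relative interior is Lagrangian. -/
def IsLagrangianFace {n : ℕ} (lam : Fin n → ℝ) (f : Set (Index n → ℝ)) : Prop :=
  ∃ u ∈ intrinsicInterior ℝ f, IsLagrangian (gcFiber lam u)

/-- A face is displaceable if every fiber over its relative interior is displaceable. -/
def IsDisplaceableFace {n : ℕ} (lam : Fin n → ℝ) (f : Set (Index n → ℝ)) : Prop :=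
  ∀ u ∈ intrinsicInterior ℝ f, IsDisplaceable (gcFiber lam u)

/-- The permutation matrix of `w` acts on `𝒪_λ` as a Hamiltonian diffeomorphism which moves the
preimage of the relative interior of the face `f` off itself. -/
def PermDisplacesFace {n : ℕ} (lam : Fin n → ℝ) (f : Set (Index n → ℝ))
    (w : Equiv.Perm (Fin n)) : Prop :=
  IsHamiltonianDiffeo (permAct (lam := lam) w) ∧
  Disjoint (permAct (lam := lam) w '' (gcMap ⁻¹' intrinsicInterior ℝ f))
    (gcMap ⁻¹' intrinsicInterior ℝ f)

/-- The pattern `λ = (t, …, t, 0, …, 0)` with `k` entries `t` and `n - k` entries `0`, for which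
`𝒪_λ` is the Grassmannian `Gr(k, n)`. -/
def grassmannPattern (k n : ℕ) (t : ℝ) : Fin n → ℝ := fun i => if (i : ℕ) < k then t else 0

/-- The face `γ_{i₁, …, i_r}` for `I = {i₁, …, i_r}`: for each `i ∈ I`, the `k²` coordinates
`u_{a,b}` with `1 ≤ a ≤ k` and `i - k + 1 ≤ b ≤ i` are equal to one another. -/
def squareFace (k n : ℕ) (t : ℝ) (I : Finset ℕ) : Set (Index n → ℝ) :=
  {u | u ∈ gcPolytope (grassmannPattern k n t) ∧
    ∀ i ∈ I, ∀ q q' : Index n,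
      (q.1.1 ≤ k ∧ i + 1 ≤ q.1.2 + k ∧ q.1.2 ≤ i) →
      (q'.1.1 ≤ k ∧ i + 1 ≤ q'.1.2 + k ∧ q'.1.2 ≤ i) → u q = u q'}

/-- `I = {i₁ < ⋯ < i_r}` with `r ≥ 1`, `k ≤ i₁`, `i_r ≤ n - k` and `i_{s+1} - i_s ≥ k`. -/
def IsSquareSequence (k n : ℕ) (I : Finset ℕ) : Prop :=
  I.Nonempty ∧ (∀ i ∈ I, k ≤ i ∧ i + k ≤ n) ∧ ∀ i ∈ I, ∀ j ∈ I, i < j → i + k ≤ j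

end GelfandCetlin

open GelfandCetlin

open GelfandCetlin

/-! ### Unitary matrices act by Hamiltonian diffeomorphisms -/

/-! Write a point of the orbit as `x = A * Aᴴ`, where `A` has two columns and `Aᴴ * A = t • 1`
(`exists_frame`). Each row of `A` gives a vector of `ℝ × ℂ`, that is of three-space (`bloch`), and
these vectors sum to zero. So `x` carries a closed spatial polygon with `p` edges, and permuting the
indices of `x` permutes the edges. The leading `j × j` block has the same nonzero spectrum as the
Gram matrix of the first `j` rows. The sum of its two top eigenvalues is the total length of the
first `j` edges, and their difference is the distance from the origin to the `j`-th vertex. Hence an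
equality between neighbouring coordinates says that the triangle spanned by the origin and one edge
is degenerate, in one of three ways (`shape_of_gcMap_eq`).

An affine inequality that is tight at one relative interior point of a face is tight on the whole
face, so all points over the relative interior have polygons of one shape. What has to be found is a
reordering of the edges that never preserves a shape with a degenerate triangle
(`exists_perm_not_sameShape`). A transposition does this, unless a proper vertex returns to the
origin while no edge vanishes. Then a cyclic rotation works, and this is where primality enters: the
indices of the vanishing vertices would be stable under a shift prime to `p`, so the first edge
would be zero. Conjugation by a unitary matrix is Hamiltonian (`isHamiltonianDiffeo_unitaryAct`), so
such a permutation displaces the face.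

It remains to see that the points in question are degenerate. At a nondegenerate point every
inequality that is not an identity on the polytope is strict, so the point lies on no proper face
(`isDegenerate_of_isProperFace`). Its fiber is a torus (`isTorus_gcFiber`): rows are added one at a
time, and, the Gram spectra being simple, only the phases of the new entries in an eigenbasis are
free. A fiber that is not a torus is displaced by treating `{u}` as a face. -/

theorem exists_skew_exp_eq {A : Type*} [CStarAlgebra A] (U : A) (hU : U ∈ unitary A)
    (hfin : (spectrum ℂ U).Finite) : ∃ X : A, star X = -X ∧ NormedSpace.exp X = U := by
  have hn : IsStarNormal U := ⟨by
    rw [commute_iff_eq, Unitary.star_mul_self_of_mem hU, Unitary.mul_star_self_of_mem hU]⟩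
  have hlog : ContinuousOn Complex.log (spectrum ℂ U) := hfin.continuousOn _
  -- Antisymmetrizing the logarithm makes skewness formal; on the unit circle it changes nothing.
  -- The branch cut is harmless because the spectrum is finite.
  refine ⟨cfc (fun z => (Complex.log z - star (Complex.log z)) / 2) U, ?_, ?_⟩
  · rw [← cfc_star, ← cfc_neg]
    refine cfc_congr fun z _ => ?_
    simp only [star_div₀, star_sub, star_star, star_ofNat]
    ring
  · rw [← CFC.complex_exp_eq_normedSpace_exp (cfc_predicate _ _),
      ← cfc_comp' Complex.exp _ U (by fun_prop) (hfin.continuousOn _)]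
    conv_rhs => rw [← cfc_id ℂ U]
    refine cfc_congr fun z hz => ?_
    have hz1 : ‖z‖ = 1 := by
      simpa using spectrum.subset_circle_of_unitary hU hz
    have hz0 : z ≠ 0 := by
      rintro rfl
      simp at hz1
    have : (Complex.log z - star (Complex.log z)) / 2 = Complex.log z := by
      apply Complex.ext <;> simp [Complex.log_re, hz1, Complex.log_im]
    simp only [this, Complex.exp_log hz0, id]

theorem Matrix.exists_skew_exp_eq {n : ℕ} (U : Mat n) (hU : U ∈ Matrix.unitaryGroup (Fin n) ℂ) :
    ∃ X : Mat n, star X = -X ∧ NormedSpace.exp X = U :=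
  @_root_.exists_skew_exp_eq (Mat n) Matrix.instCStarAlgebra U hU (Matrix.finite_spectrum U)

/-- With `U = exp X`, conjugation by `exp (s • X)` is the flow of the linear Hamiltonian `z ↦ Re
tr(i X z)`, since `tr(z ⁅X, Y⁆) = tr(X ⁅Y, z⁆)`. -/
theorem isHamiltonianDiffeo_unitaryAct {n : ℕ} {lam : Fin n → ℝ}
    (U : Matrix.unitaryGroup (Fin n) ℂ) :
    IsHamiltonianDiffeo (unitaryAct (lam := lam) U) := by
  obtain ⟨X, hX, hU⟩ := Matrix.exists_skew_exp_eq (U : Mat n) U.2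
  have hstar : ∀ s : ℝ, star (NormedSpace.exp (s • X)) = NormedSpace.exp (-(s • X)) := by
    intro s
    rw [NormedSpace.star_exp, star_smul, hX]
    simp
  have hinv : ∀ s : ℝ, NormedSpace.exp (s • X) * NormedSpace.exp (-(s • X)) = 1 := by
    intro s
    rw [← Matrix.exp_add_of_commute _ _ (Commute.refl (s • X)).neg_right, add_neg_cancel,
      NormedSpace.exp_zero]
  have hmem : ∀ s : ℝ, NormedSpace.exp (s • X) ∈ Matrix.unitaryGroup (Fin n) ℂ := by
    intro s
    rw [Matrix.mem_unitaryGroup_iff, hstar, hinv]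
  let Λ : Mat n →ₗ[ℝ] ℝ :=
    { toFun := fun z => (Matrix.trace (Complex.I • (X * z))).re
      map_add' := by intro a b; simp [mul_add]
      map_smul' := by intro c a; simp [Matrix.trace_smul] }
  let Λ' : Mat n →L[ℝ] ℝ := LinearMap.toContinuousLinearMap Λ
  refine ⟨fun _ z => Λ' z, fun s x => unitaryAct ⟨_, hmem s⟩ x, ?_, ?_, ?_, ?_⟩
  · exact Λ'.contDiff.comp contDiff_snd
  · intro x
    apply Subtype.ext
    simp [unitaryAct]
  · intro x
    apply Subtype.ext
    simp [unitaryAct, hU]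
  · intro s _ x
    refine ⟨X, hX, ?_, ?_⟩
    · apply HasDerivAt.hasDerivWithinAt
      have h1 := hasDerivAt_exp_smul_const' (𝕂 := ℝ) X s
      have h2 := hasDerivAt_exp_smul_const (𝕂 := ℝ) (-X) s
      have h3 := (h1.mul_const (x : Mat n)).mul h2
      have e : (fun r : ℝ => ((unitaryAct ⟨_, hmem r⟩ x : orbit lam) : Mat n)) =
          (fun r : ℝ => NormedSpace.exp (r • X) * (x : Mat n)) *
            fun r : ℝ => NormedSpace.exp (r • -X) := by
        funext r
        simp [unitaryAct, hstar]
      rw [e]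
      convert! h3 using 1
      simp only [unitaryAct, hstar, Ring.lie_def, smul_neg]
      noncomm_ring
    · intro Y _
      rw [ContinuousLinearMap.fderiv]
      change _ = (Matrix.trace (Complex.I • (X * _))).re
      unfold kks
      congr 1
      simp only [Matrix.trace_smul]
      congr 1
      simp only [Ring.lie_def, mul_sub, Matrix.trace_sub, ← mul_assoc]
      rw [Matrix.trace_mul_cycle _ X Y, Matrix.trace_mul_cycle _ Y X, Matrix.trace_mul_cycle Y,
        Matrix.trace_mul_cycle X]

/-! ### Polygons and their degenerate triangles -/

section Polygon

set_option linter.unusedSectionVars false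

variable {V : Type*} [NormedAddCommGroup V] [NormedSpace ℝ V]

/-- The vertices of the polygon with edges `e`. -/
def vertex (e : ℕ → V) (j : ℕ) : V := ∑ i ∈ Finset.range j, e i

theorem vertex_zero (e : ℕ → V) : vertex e 0 = 0 := by simp [vertex]

theorem vertex_succ (e : ℕ → V) (j : ℕ) : vertex e (j + 1) = vertex e j + e j :=
  Finset.sum_range_succ _ _

theorem vertex_congr {e e' : ℕ → V} {j : ℕ} (h : ∀ i < j, e i = e' i) :
    vertex e j = vertex e' j :=
  Finset.sum_congr rfl fun i hi => h i (Finset.mem_range.mp hi)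

/-- The edge `e j` points back towards the origin without passing it. -/
def Shrinks (e : ℕ → V) (j : ℕ) : Prop := ‖vertex e j‖ = ‖vertex e (j + 1)‖ + ‖e j‖

/-- The edge `e j` points away from the origin. -/
def Grows (e : ℕ → V) (j : ℕ) : Prop := ‖vertex e (j + 1)‖ = ‖vertex e j‖ + ‖e j‖

/-- The edge `e j` passes through the origin. -/
def Folds (e : ℕ → V) (j : ℕ) : Prop := ‖e j‖ = ‖vertex e j‖ + ‖vertex e (j + 1)‖

/-- The triangle spanned by the origin and the edge `e j` is degenerate. -/
def IsFlat (e : ℕ → V) (j : ℕ) : Prop := Shrinks e j ∨ Grows e j ∨ Folds e j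

/-- The first `p` triangles of two polygons are degenerate in the same way. -/
def SameShape (p : ℕ) (e e' : ℕ → V) : Prop :=
  ∀ j < p, (Shrinks e j ↔ Shrinks e' j) ∧ (Grows e j ↔ Grows e' j) ∧ (Folds e j ↔ Folds e' j)

/-- Adding the two norm equalities leaves `2‖e j‖ = 0`. Together with the analogue for vertices,
this makes the zero edges and zero vertices invariants of the shape. -/
theorem edge_eq_zero_iff (e : ℕ → V) (j : ℕ) : e j = 0 ↔ Shrinks e j ∧ Grows e j := by
  unfold Shrinks Grows
  constructor
  · intro h
    simp [vertex_succ, h]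
  · rintro ⟨h₁, h₂⟩
    rw [← norm_eq_zero]
    linarith

theorem vertex_eq_zero_iff (e : ℕ → V) (j : ℕ) : vertex e j = 0 ↔ Grows e j ∧ Folds e j := by
  unfold Grows Folds
  constructor
  · intro h
    simp [vertex_succ, h]
  · rintro ⟨h₁, h₂⟩
    rw [← norm_eq_zero]
    linarith

namespace SameShape

variable {p : ℕ} {e e' : ℕ → V}

theorem edge_eq_zero_iff (h : SameShape p e e') {j : ℕ} (hj : j < p) : e j = 0 ↔ e' j = 0 := by
  rw [_root_.edge_eq_zero_iff, _root_.edge_eq_zero_iff, (h j hj).1, (h j hj).2.1]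

theorem vertex_eq_zero_iff (h : SameShape p e e') {j : ℕ} (hj : j < p) :
    vertex e j = 0 ↔ vertex e' j = 0 := by
  rw [_root_.vertex_eq_zero_iff, _root_.vertex_eq_zero_iff, (h j hj).2.1, (h j hj).2.2]

theorem isFlat_iff (h : SameShape p e e') {j : ℕ} (hj : j < p) : IsFlat e j ↔ IsFlat e' j := by
  unfold IsFlat
  rw [(h j hj).1, (h j hj).2.1, (h j hj).2.2]

end SameShape

/-- Equality in the triangle inequality puts two sides on one ray, by strict convexity. The far
vertex serves as reference because exchanging two consecutive edges does not move it. -/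
theorem IsFlat.exists_smul [StrictConvexSpace ℝ V] {e : ℕ → V} {j : ℕ} (h : IsFlat e j)
    (hne : vertex e (j + 1) ≠ 0) : ∃ r : ℝ, e j = r • vertex e (j + 1) := by
  have hs := vertex_succ e j
  rcases h with h | h | h
  · have hr : SameRay ℝ (vertex e (j + 1)) (-e j) := by
      rw [sameRay_iff_norm_add, norm_neg, ← h, hs]
      simp
    obtain ⟨r, -, hr⟩ := hr.exists_nonneg_left hne
    exact ⟨-r, by rw [neg_smul, hr, neg_neg]⟩
  · have hr : SameRay ℝ (vertex e j) (e j) := by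
      rw [sameRay_iff_norm_add, ← h, hs]
    have hr' : SameRay ℝ (vertex e (j + 1)) (e j) := by
      rw [hs]
      exact hr.add_left (SameRay.refl _)
    obtain ⟨r, -, hr⟩ := hr'.exists_nonneg_left hne
    exact ⟨r, hr.symm⟩
  · have hr : SameRay ℝ (vertex e (j + 1)) (-vertex e j) := by
      rw [sameRay_iff_norm_add, norm_neg, add_comm ‖vertex e (j + 1)‖, ← h, hs]
      simp
    obtain ⟨r, -, hr⟩ := hr.exists_nonneg_left hne
    refine ⟨1 + r, ?_⟩
    rw [add_smul, one_smul, hr, hs]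
    abel

/-- The ranges `r ≤ 0`, `0 ≤ r ≤ 1` and `1 ≤ r` give `Shrinks`, `Grows` and `Folds`. -/
theorem isFlat_of_eq_smul {e : ℕ → V} {j : ℕ} {r : ℝ} (h : e j = r • vertex e (j + 1)) :
    IsFlat e j := by
  have hs : vertex e j = (1 - r) • vertex e (j + 1) := by
    rw [sub_smul, one_smul, ← h, vertex_succ]
    abel
  unfold IsFlat Shrinks Grows Folds
  rw [hs, h, norm_smul, norm_smul, Real.norm_eq_abs, Real.norm_eq_abs]
  rcases le_total r 0 with h0 | h0
  · left
    rw [abs_of_nonpos h0, abs_of_nonneg (by linarith)]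
    ring
  · rcases le_total r 1 with h1 | h1
    · right; left
      rw [abs_of_nonneg h0, abs_of_nonneg (by linarith)]
      ring
    · right; right
      rw [abs_of_nonneg h0, abs_of_nonpos (by linarith)]
      ring

/-- The periodic sequence of edges of a polygon with `p` edges. -/
def periodize {p : ℕ} [NeZero p] (e : Fin p → V) (n : ℕ) : V := e (Fin.ofNat p n)

theorem periodize_comp_swap {p : ℕ} [NeZero p] (e : Fin p → V) {a b n : ℕ} (ha : a < p)
    (hb : b < p) (hn : n < p) :
    periodize (e ∘ Equiv.swap (Fin.ofNat p a) (Fin.ofNat p b)) n =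
      if n = a then periodize e b else if n = b then periodize e a else periodize e n := by
  have key : ∀ {x : ℕ}, x < p → (Fin.ofNat p n = Fin.ofNat p x ↔ n = x) := by
    intro x hx
    simp [Fin.ext_iff, Nat.mod_eq_of_lt hn, Nat.mod_eq_of_lt hx]
  simp only [periodize, Function.comp_apply, Equiv.swap_apply_def, key ha, key hb]
  split_ifs <;> rfl

theorem vertex_periodize_self {p : ℕ} [NeZero p] (e : Fin p → V) :
    vertex (periodize e) p = ∑ i, e i := by
  rw [vertex, ← Fin.sum_univ_eq_sum_range]
  refine Finset.sum_congr rfl fun i _ => ?_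
  simp [periodize]

theorem periodize_comp_addRight {p : ℕ} [NeZero p] (e : Fin p → V) (c n : ℕ) :
    periodize (e ∘ Equiv.addRight (Fin.ofNat p c)) n = periodize e (n + c) := by
  simp only [periodize, Function.comp_apply, Equiv.coe_addRight]
  congr 1
  ext
  simp [Fin.val_add, Nat.add_mod]

/-- Rotating the order of the edges moves the base point to the `c`-th vertex. -/
theorem vertex_periodize_add {p : ℕ} [NeZero p] (e : Fin p → V) (c n : ℕ) :
    vertex (periodize (e ∘ Equiv.addRight (Fin.ofNat p c))) n =
      vertex (periodize e) (n + c) - vertex (periodize e) c := by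
  induction n with
  | zero => simp [vertex_zero]
  | succ n ih =>
    rw [vertex_succ, ih, periodize_comp_addRight, show n + 1 + c = n + c + 1 by ring, vertex_succ]
    abel

theorem vertex_periodize_mod {p : ℕ} [NeZero p] {e : Fin p → V} (h : ∑ i, e i = 0) (n : ℕ) :
    vertex (periodize e) n = vertex (periodize e) (n % p) := by
  have hp : ∀ m, vertex (periodize e) (m + p) = vertex (periodize e) m := by
    intro m
    have h1 := vertex_periodize_add e p m
    rw [vertex_periodize_self, h, sub_zero] at h1
    rw [← h1]
    congr 2
    ext i
    simp
  exact (Function.Periodic.map_mod_nat (f := vertex (periodize e)) hp n).symm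

/-! ### Reorderings that destroy a given shape -/

variable {p : ℕ} [Fact p.Prime] {e₀ : Fin p → V}

/-- Exchanging the zero edge with a nonzero one puts a zero edge where the shape forbids it. -/
theorem exists_perm_of_edge_eq_zero (hne : e₀ ≠ 0) {j : ℕ} (hj : j < p)
    (h0 : periodize e₀ j = 0) :
    ∃ w : Equiv.Perm (Fin p), ∀ e : Fin p → V, SameShape p (periodize e) (periodize e₀) →
      ¬ SameShape p (periodize (e ∘ w)) (periodize e₀) := by
  obtain ⟨k, hk⟩ := Function.ne_iff.mp hne
  have hk' : periodize e₀ k ≠ 0 := by simpa [periodize] using hk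
  refine ⟨Equiv.swap (Fin.ofNat p k) (Fin.ofNat p j), fun e he he' => ?_⟩
  have h1 := he'.edge_eq_zero_iff k.2
  rw [periodize_comp_swap e k.2 hj k.2, if_pos rfl, he.edge_eq_zero_iff hj] at h1
  exact hk' (h1.mp h0)

/-- Rotation by `c` keeps the base point at the origin. If it kept the shape, the vertices at all
multiples of `c` would vanish; modulo the prime `p` one multiple is `1`, so the first edge would
vanish. -/
theorem exists_perm_of_vertex_eq_zero (hsum : ∑ i, e₀ i = 0) (hnz : ∀ j < p, periodize e₀ j ≠ 0)
    {c : ℕ} (hc : 0 < c) (hcp : c < p) (h0 : vertex (periodize e₀) c = 0) :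
    ∃ w : Equiv.Perm (Fin p), ∀ e : Fin p → V, ∑ i, e i = 0 →
      SameShape p (periodize e) (periodize e₀) →
      ¬ SameShape p (periodize (e ∘ w)) (periodize e₀) := by
  have hp : p.Prime := Fact.out
  refine ⟨Equiv.addRight (Fin.ofNat p c), fun e hes he he' => ?_⟩
  have hiff : ∀ n, vertex (periodize e) n = 0 ↔ vertex (periodize e₀) n = 0 := by
    intro n
    rw [vertex_periodize_mod hes, vertex_periodize_mod hsum]
    exact he.vertex_eq_zero_iff (Nat.mod_lt _ hp.pos)
  have hes' : ∑ i, (e ∘ Equiv.addRight (Fin.ofNat p c)) i = 0 := by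
    rw [← hes]
    exact Equiv.sum_comp (Equiv.addRight (Fin.ofNat p c)) e
  have hiff' : ∀ n, vertex (periodize e) (n + c) = 0 ↔ vertex (periodize e₀) n = 0 := by
    intro n
    have hadd := vertex_periodize_add e c n
    rw [(hiff c).mpr h0, sub_zero] at hadd
    rw [← hadd, vertex_periodize_mod hes', vertex_periodize_mod hsum n]
    exact he'.vertex_eq_zero_iff (Nat.mod_lt _ hp.pos)
  have hmul : ∀ m, vertex (periodize e₀) (m * c) = 0 := by
    intro m
    induction m with
    | zero => simp [vertex_zero]
    | succ m ih => rw [Nat.succ_mul, ← hiff, hiff', ih]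
  have hcop : Nat.Coprime c p :=
    ((Nat.Prime.coprime_iff_not_dvd hp).mpr (Nat.not_dvd_of_pos_of_lt hc hcp)).symm
  obtain ⟨m, -, hm⟩ := Nat.exists_mul_mod_eq_one_of_coprime hcop hp.one_lt
  have h1 := hmul m
  rw [vertex_periodize_mod hsum, mul_comm, hm, vertex_succ, vertex_zero, zero_add] at h1
  exact hnz 0 hp.pos h1

variable [StrictConvexSpace ℝ V]

/-- While the edges point outwards, the polygon runs straight along its first edge. -/
theorem sameRay_vertex_edge_zero {e : ℕ → V} {k : ℕ} (h0 : e 0 ≠ 0)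
    (h : ∀ j, 1 ≤ j → j < k → Grows e j) (j : ℕ) (hj : j + 1 ≤ k) :
    vertex e (j + 1) ≠ 0 ∧ SameRay ℝ (vertex e (j + 1)) (e 0) := by
  induction j with
  | zero =>
    have h1 : vertex e (0 + 1) = e 0 := by simp [vertex]
    rw [h1]
    exact ⟨h0, SameRay.refl _⟩
  | succ j ih =>
    obtain ⟨hne, hray⟩ := ih (by omega)
    have hg := h (j + 1) (by omega) (by omega)
    constructor
    · rw [← norm_pos_iff, hg]
      have := norm_pos_iff.mpr hne
      positivity
    · unfold Grows at hg
      rw [vertex_succ _ (j + 1), ← sameRay_iff_norm_add] at hg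
      rw [vertex_succ]
      exact hray.add_left (hg.symm.trans hray fun h => absurd h hne)

/-- Let `k` be the first place after `0` where the polygon stops running straight outwards. If
exchanging the edges `1` and `k` kept the shape, edge `k` would point along edge `0`, hence along
the `k`-th vertex, and would grow after all. -/
theorem exists_perm_of_grows (hp3 : 3 ≤ p) (hsum : ∑ i, e₀ i = 0)
    (hnz : ∀ j < p, periodize e₀ j ≠ 0) (h1 : Grows (periodize e₀) 1) :
    ∃ w : Equiv.Perm (Fin p), ∀ e : Fin p → V,
      SameShape p (periodize e) (periodize e₀) →
      ¬ SameShape p (periodize (e ∘ w)) (periodize e₀) := by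
  classical
  have hex : ∃ k, 1 ≤ k ∧ k < p ∧ ¬ Grows (periodize e₀) k := by
    -- The last edge is nonzero and ends at the origin, so it cannot grow.
    refine ⟨p - 1, by omega, by omega, fun h => ?_⟩
    unfold Grows at h
    rw [show p - 1 + 1 = p by omega, vertex_periodize_self, hsum, norm_zero] at h
    have := norm_pos_iff.mpr (hnz (p - 1) (by omega))
    have := norm_nonneg (vertex (periodize e₀) (p - 1))
    linarith
  obtain ⟨hk1, hkp, hk⟩ := Nat.find_spec hex
  have hmin : ∀ j, 1 ≤ j → j < Nat.find hex → Grows (periodize e₀) j := by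
    intro j hj1 hj
    by_contra hcon
    exact Nat.find_min hex hj ⟨hj1, by omega, hcon⟩
  generalize Nat.find hex = k at *
  have hk2 : 2 ≤ k := by
    by_contra hcon
    obtain rfl : k = 1 := by omega
    exact hk h1
  refine ⟨Equiv.swap (Fin.ofNat p 1) (Fin.ofNat p k), fun e he he' => ?_⟩
  have hz : periodize e 0 ≠ 0 := fun h => hnz 0 (by omega) ((he.edge_eq_zero_iff (by omega)).mp h)
  have hray := (sameRay_vertex_edge_zero (e := periodize e) (k := k) hz
    (fun j hj1 hj => ((he j (by omega)).2.1).mpr (hmin j hj1 hj)) (k - 1) (by omega)).2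
  rw [show k - 1 + 1 = k by omega] at hray
  have hg := ((he' 1 (by omega)).2.1).mpr h1
  unfold Grows at hg
  have hs : ∀ n < p, _ := fun n hn => periodize_comp_swap e (a := 1) (b := k) (by omega) hkp hn
  have e0 : periodize (e ∘ Equiv.swap (Fin.ofNat p 1) (Fin.ofNat p k)) 0 = periodize e 0 := by
    rw [hs 0 (by omega), if_neg (by omega), if_neg (by omega)]
  have e1 : periodize (e ∘ Equiv.swap (Fin.ofNat p 1) (Fin.ofNat p k)) 1 = periodize e k := by
    rw [hs 1 (by omega), if_pos rfl]
  rw [vertex_succ, vertex_succ, vertex_zero, zero_add, e0, e1, ← sameRay_iff_norm_add] at hg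
  have hfin : SameRay ℝ (vertex (periodize e) k) (periodize e k) :=
    hray.trans hg fun h => absurd h hz
  rw [sameRay_iff_norm_add, ← vertex_succ] at hfin
  exact hk (((he k hkp).2.1).mp hfin)

/-- Exchange the edges `j` and `j + 1`, which fixes vertex `j + 2`. If the shape survived, both
edges would be parallel to that vertex, so triangle `j` would already be flat. -/
theorem exists_perm_of_isFlat
    (hvz : ∀ j, 0 < j → j < p → vertex (periodize e₀) j ≠ 0) {j : ℕ} (hj : j + 3 ≤ p)
    (hflat : IsFlat (periodize e₀) (j + 1)) (hnot : ¬ IsFlat (periodize e₀) j) :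
    ∃ w : Equiv.Perm (Fin p), ∀ e : Fin p → V,
      SameShape p (periodize e) (periodize e₀) →
      ¬ SameShape p (periodize (e ∘ w)) (periodize e₀) := by
  refine ⟨Equiv.swap (Fin.ofNat p j) (Fin.ofNat p (j + 1)), fun e he he' => hnot ?_⟩
  have hs : ∀ n < p, _ := fun n hn =>
    periodize_comp_swap e (a := j) (b := j + 1) (by omega) (by omega) hn
  set e' := e ∘ Equiv.swap (Fin.ofNat p j) (Fin.ofNat p (j + 1))
  have ej : periodize e' j = periodize e (j + 1) := by
    rw [hs j (by omega), if_pos rfl]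
  have ej1 : periodize e' (j + 1) = periodize e j := by
    rw [hs (j + 1) (by omega), if_neg (by omega), if_pos rfl]
  have hv : vertex (periodize e') j = vertex (periodize e) j := by
    refine vertex_congr fun i hi => ?_
    rw [hs i (by omega), if_neg (by omega), if_neg (by omega)]
  have hv2 : vertex (periodize e') (j + 1 + 1) = vertex (periodize e) (j + 1 + 1) := by
    simp only [vertex_succ, hv, ej, ej1]
    abel
  have hv2z : vertex (periodize e) (j + 1 + 1) ≠ 0 := fun h =>
    hvz (j + 1 + 1) (by omega) (by omega) ((he.vertex_eq_zero_iff (by omega)).mp h)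
  have hv1z : vertex (periodize e) (j + 1) ≠ 0 := fun h =>
    hvz (j + 1) (by omega) (by omega) ((he.vertex_eq_zero_iff (by omega)).mp h)
  obtain ⟨r, hr⟩ := ((he.isFlat_iff (by omega)).mpr hflat).exists_smul hv2z
  obtain ⟨r', hr'⟩ := ((he'.isFlat_iff (by omega)).mpr hflat).exists_smul (hv2 ▸ hv2z)
  rw [hv2, ej1] at hr'
  have h1 : vertex (periodize e) (j + 1) = (1 - r) • vertex (periodize e) (j + 1 + 1) := by
    rw [sub_smul, one_smul, ← hr, vertex_succ _ (j + 1)]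
    abel
  have hr1 : 1 - r ≠ 0 := by
    intro h
    rw [h, zero_smul] at h1
    exact hv1z h1
  rw [← he.isFlat_iff (by omega)]
  refine isFlat_of_eq_smul (r := r' / (1 - r)) ?_
  rw [h1, smul_smul, div_mul_cancel₀ _ hr1, hr']

/-- A shape with a degenerate triangle is destroyed by some reordering of the edges. -/
theorem exists_perm_not_sameShape (hsum : ∑ i, e₀ i = 0) (hne : e₀ ≠ 0)
    (hflat : ∃ j, 1 ≤ j ∧ j + 2 ≤ p ∧ IsFlat (periodize e₀) j) :
    ∃ w : Equiv.Perm (Fin p), ∀ e : Fin p → V, ∑ i, e i = 0 →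
      SameShape p (periodize e) (periodize e₀) →
      ¬ SameShape p (periodize (e ∘ w)) (periodize e₀) := by
  classical
  by_cases hnz : ∃ j < p, periodize e₀ j = 0
  · obtain ⟨j, hj, h0⟩ := hnz
    obtain ⟨w, hw⟩ := exists_perm_of_edge_eq_zero hne hj h0
    exact ⟨w, fun e _ => hw e⟩
  push Not at hnz
  by_cases hvz : ∃ j, 0 < j ∧ j < p ∧ vertex (periodize e₀) j = 0
  · obtain ⟨j, hj, hjp, h0⟩ := hvz
    exact exists_perm_of_vertex_eq_zero hsum hnz hj hjp h0
  push Not at hvz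
  have hp3 : 3 ≤ p := by
    obtain ⟨j, h1, h2, -⟩ := hflat
    omega
  by_cases h1 : IsFlat (periodize e₀) 1
  · by_cases hg : Grows (periodize e₀) 1
    · obtain ⟨w, hw⟩ := exists_perm_of_grows hp3 hsum hnz hg
      exact ⟨w, fun e _ => hw e⟩
    -- In the remaining two cases one of the first two edges is longer than the other by `‖vertex
    -- 2‖`. Exchanging them reverses the roles, so both relations together force vertex `2` to be
    -- zero.
    refine ⟨Equiv.swap (Fin.ofNat p 0) (Fin.ofNat p 1), fun e _ he he' => ?_⟩
    have hs : ∀ n < p, _ := fun n hn =>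
      periodize_comp_swap e (a := 0) (b := 1) (by omega) (by omega) hn
    set e' := e ∘ Equiv.swap (Fin.ofNat p 0) (Fin.ofNat p 1)
    have e0 : periodize e' 0 = periodize e 1 := by rw [hs 0 (by omega), if_pos rfl]
    have e1 : periodize e' 1 = periodize e 0 := by
      rw [hs 1 (by omega), if_neg (by omega), if_pos rfl]
    have hv : ‖vertex (periodize e) 2‖ ≠ 0 := by
      rw [norm_ne_zero_iff]
      exact fun h => hvz 2 (by omega) (by omega) ((he.vertex_eq_zero_iff (by omega)).mp h)
    have hv2 : vertex (periodize e') 2 = vertex (periodize e) 2 := by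
      simp only [vertex_succ, vertex_zero, e0, e1]
      abel
    have hv1 : vertex (periodize e) 1 = periodize e 0 := by simp [vertex]
    have hv1' : vertex (periodize e') 1 = periodize e 1 := by simp [vertex, e0]
    rcases h1 with h | h | h
    · have a := ((he 1 (by omega)).1).mpr h
      have b := ((he' 1 (by omega)).1).mpr h
      simp only [Shrinks, Nat.reduceAdd, hv1, hv1', hv2, e1] at a b
      exact hv (by linarith)
    · exact hg h
    · have a := ((he 1 (by omega)).2.2).mpr h
      have b := ((he' 1 (by omega)).2.2).mpr h
      simp only [Folds, Nat.reduceAdd, hv1, hv1', hv2, e1] at a b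
      exact hv (by linarith)
  -- The first flat triangle is not the initial one, so it is preceded by a non-flat one.
  · obtain ⟨hk1, hk2, hk⟩ := Nat.find_spec hflat
    have hmin := fun m => Nat.find_min hflat (m := m)
    generalize Nat.find hflat = k at *
    have hk3 : k ≠ 1 := by
      rintro rfl
      exact h1 hk
    obtain ⟨j, rfl⟩ : ∃ j, k = j + 1 := ⟨k - 1, by omega⟩
    obtain ⟨w, hw⟩ := exists_perm_of_isFlat hvz (j := j) (by omega) hk
      fun h => hmin j (by omega) ⟨by omega, by omega, h⟩
    exact ⟨w, fun e _ => hw e⟩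

end Polygon

/-! ### The Grassmannian as the set of matrices `A * Aᴴ` -/

section Frames

open Matrix Polynomial

theorem sum_grassmannPattern_mul {n : ℕ} (hn : 2 ≤ n) (t : ℝ) (f : Fin n → ℂ) :
    ∑ l, (grassmannPattern 2 n t l : ℂ) * f l = t * ∑ c : Fin 2, f (Fin.castLE hn c) := by
  obtain ⟨m, rfl⟩ : ∃ m, n = m + 2 := ⟨n - 2, by omega⟩
  rw [Fin.sum_univ_succ, Fin.sum_univ_succ, Fin.sum_univ_two]
  simp [grassmannPattern, mul_add]
  exact Or.inl rfl

/-- Only the first two columns of the unitary matrix meet a nonzero eigenvalue; scaled by `√t` they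
form the frame. -/
theorem exists_frame {n : ℕ} (hn : 2 ≤ n) {t : ℝ} (ht : 0 < t)
    (x : orbit (grassmannPattern 2 n t)) :
    ∃ A : Matrix (Fin n) (Fin 2) ℂ, Aᴴ * A = (t : ℂ) • 1 ∧ (x : Mat n) = A * Aᴴ := by
  obtain ⟨x, U, hU, rfl⟩ := x
  have hs : ((√t : ℝ) : ℂ) * ((√t : ℝ) : ℂ) = t := by
    rw [← Complex.ofReal_mul, Real.mul_self_sqrt ht.le]
  refine ⟨((√t : ℝ) : ℂ) • U.submatrix id (Fin.castLE hn), ?_, ?_⟩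
  · rw [conjTranspose_smul, Matrix.smul_mul, Matrix.mul_smul, smul_smul, conjTranspose_submatrix,
      ← submatrix_mul _ _ _ id _ Function.bijective_id, ← star_eq_conjTranspose,
      (Matrix.mem_unitaryGroup_iff').mp hU, submatrix_one _ (Fin.castLE_injective hn)]
    simp [hs]
  · ext i k
    have h := sum_grassmannPattern_mul hn t fun l => U i l * star (U k l)
    simp only [mul_apply, star_apply, diagonal_apply, mul_ite, mul_zero, Finset.sum_ite_eq',
      Finset.mem_univ, if_true, Matrix.smul_apply, conjTranspose_apply, submatrix_apply, id,
      smul_eq_mul]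
    rw [Finset.mul_sum] at h
    rw [← Finset.sum_congr rfl fun l _ => (by ring :
      (grassmannPattern 2 n t l : ℂ) * (U i l * star (U k l)) =
        U i l * (grassmannPattern 2 n t l : ℂ) * star (U k l)), h]
    refine Finset.sum_congr rfl fun c _ => ?_
    rw [← hs]
    simp
    ring

theorem mem_orbit_of_frame {n : ℕ} (hn : 2 ≤ n) {t : ℝ} (ht : 0 < t)
    {A : Matrix (Fin n) (Fin 2) ℂ} (hA : Aᴴ * A = (t : ℂ) • 1) :
    A * Aᴴ ∈ orbit (grassmannPattern 2 n t) := by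
  have hs : ((√t : ℝ) : ℂ) * ((√t : ℝ) : ℂ) = t := by
    rw [← Complex.ofReal_mul, Real.mul_self_sqrt ht.le]
  have hs0 : ((√t : ℝ) : ℂ) ≠ 0 := by
    rw [Complex.ofReal_ne_zero]
    positivity
  have ht0 : (t : ℂ) ≠ 0 := by exact_mod_cast ht.ne'
  let v : Fin n → EuclideanSpace ℂ (Fin n) := fun l =>
    WithLp.toLp 2 fun i => if h : (l : ℕ) < 2 then ((√t : ℝ) : ℂ)⁻¹ * A i ⟨l, h⟩ else 0
  have hv : Orthonormal ℂ (({l : Fin n | (l : ℕ) < 2} : Set (Fin n)).domRestrict v) := by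
    rw [orthonormal_iff_ite]
    rintro ⟨k, hk⟩ ⟨l, hl⟩
    have h := congrFun (congrFun hA ⟨k, hk⟩) ⟨l, hl⟩
    simp only [mul_apply, conjTranspose_apply, Matrix.smul_apply, one_apply, Fin.mk.injEq,
      smul_eq_mul] at h
    have hentry : ∀ i, v k i = ((√t : ℝ) : ℂ)⁻¹ * A i ⟨k, hk⟩ ∧
        v l i = ((√t : ℝ) : ℂ)⁻¹ * A i ⟨l, hl⟩ := fun i => ⟨dif_pos hk, dif_pos hl⟩
    have hterm : ∀ i, v l i * (starRingEnd ℂ) (v k i) =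
        (t : ℂ)⁻¹ * (star (A i ⟨k, hk⟩) * A i ⟨l, hl⟩) := by
      intro i
      rw [(hentry i).1, (hentry i).2, map_mul, map_inv₀, Complex.conj_ofReal, ← hs,
        starRingEnd_apply]
      field_simp
    simp only [Set.domRestrict_apply, PiLp.inner_apply, RCLike.inner_apply, hterm,
      Subtype.mk.injEq]
    rw [← Finset.mul_sum, h]
    simp only [Fin.ext_iff]
    split_ifs <;> simp [ht0]
  obtain ⟨b, hb⟩ := hv.exists_orthonormalBasis_extension_of_card_eq (by simp)
  have hU : (Matrix.of fun i l => b l i : Mat n) ∈ Matrix.unitaryGroup (Fin n) ℂ := by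
    rw [Matrix.mem_unitaryGroup_iff']
    ext k l
    have h := (orthonormal_iff_ite.mp b.orthonormal) k l
    rw [PiLp.inner_apply] at h
    simp only [mul_apply, star_apply, of_apply, one_apply]
    rw [← h]
    exact Finset.sum_congr rfl fun i _ => by simp [mul_comm]
  refine ⟨_, hU, ?_⟩
  ext i k
  have h := sum_grassmannPattern_mul hn t fun l => b l i * star (b l k)
  simp only [mul_apply, star_apply, diagonal_apply, mul_ite, mul_zero, Finset.sum_ite_eq',
    Finset.mem_univ, if_true, conjTranspose_apply, of_apply]
  rw [Finset.sum_congr rfl fun l _ => (by ring :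
      b l i * (grassmannPattern 2 n t l : ℂ) * star (b l k) =
      (grassmannPattern 2 n t l : ℂ) * (b l i * star (b l k))), h, Finset.mul_sum]
  refine Finset.sum_congr rfl fun c _ => ?_
  rw [hb _ (show ((Fin.castLE hn c : Fin n) : ℕ) < 2 from c.2)]
  simp only [v, Fin.val_castLE, Fin.is_lt, dif_pos, Fin.eta]
  rw [← hs]
  simp
  field_simp

/-! ### The polytope -/

/-- The coordinate `u_{1,j}`, the largest eigenvalue of the leading `j × j` submatrix. -/
noncomputable def top {n : ℕ} (u : Index n → ℝ) (j : ℕ) : ℝ :=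
  if h : 1 ≤ j ∧ j ≤ n then u ⟨(1, j), by omega, by omega, by omega⟩ else 0

/-- The coordinate `u_{2,j-1}`, the second eigenvalue of the leading `j × j` submatrix. -/
noncomputable def second {n : ℕ} (u : Index n → ℝ) (j : ℕ) : ℝ :=
  if h : 2 ≤ j ∧ j ≤ n then u ⟨(2, j - 1), by omega, by omega, by simp; omega⟩ else 0

variable {n : ℕ} {t : ℝ} {u : Index n → ℝ}

theorem top_eq (u : Index n → ℝ) {q : Index n} (hq : q.1.1 = 1) : u q = top u q.1.2 := by
  obtain ⟨⟨i, j⟩, h1, h2, h3⟩ := q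
  obtain rfl : i = 1 := hq
  rw [top, dif_pos ⟨h2, by simpa [add_comm] using h3⟩]

theorem second_eq (u : Index n → ℝ) {q : Index n} (hq : q.1.1 = 2) :
    u q = second u (q.1.2 + 1) := by
  obtain ⟨⟨i, j⟩, h1, h2, h3⟩ := q
  obtain rfl : i = 2 := hq
  have h2' : 1 ≤ j := h2
  have h3' : 2 + j ≤ n + 1 := h3
  rw [second, dif_pos ⟨by simp; omega, by simp; omega⟩]
  rfl

/-- Move along the row to the boundary, where the entries are prescribed; the lower bound below
moves along the column. -/
theorem le_pattern {lam : Fin n → ℝ} (hu : u ∈ gcPolytope lam) (q : Index n) (i : Fin n)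
    (hi : q.1.1 = (i : ℕ) + 1) : u q ≤ lam i := by
  obtain ⟨d, hd⟩ : ∃ d, q.1.1 + q.1.2 + d = n + 1 := ⟨n + 1 - (q.1.1 + q.1.2), by
    have := q.2; omega⟩
  induction d generalizing q with
  | zero => exact (hu.1 q i (by omega) hi).le
  | succ d ih =>
    have h := q.2
    refine (hu.2.1 q ⟨(q.1.1, q.1.2 + 1), by omega, by simp, by simp; omega⟩ rfl rfl).trans ?_
    exact ih _ hi (by simp; omega)

theorem pattern_le {lam : Fin n → ℝ} (hu : u ∈ gcPolytope lam) (q : Index n) (i : Fin n)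
    (hi : q.1.2 + i = n) : lam i ≤ u q := by
  obtain ⟨d, hd⟩ : ∃ d, q.1.1 + q.1.2 + d = n + 1 := ⟨n + 1 - (q.1.1 + q.1.2), by
    have := q.2; omega⟩
  induction d generalizing q with
  | zero => exact (hu.1 q i (by omega) (by omega)).ge
  | succ d ih =>
    have h := q.2
    refine le_trans ?_ (hu.2.2 q ⟨(q.1.1 + 1, q.1.2), by simp, by omega, by simp; omega⟩ rfl rfl)
    exact ih _ hi (by simp; omega)

theorem coord_nonneg (ht : 0 < t) (hu : u ∈ gcPolytope (grassmannPattern 2 n t)) (q : Index n) :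
    0 ≤ u q := by
  have h := q.2
  refine le_trans ?_ (pattern_le hu q ⟨n - q.1.2, by omega⟩ (by simp; omega))
  unfold grassmannPattern
  split_ifs <;> linarith

theorem coord_le (ht : 0 < t) (hu : u ∈ gcPolytope (grassmannPattern 2 n t)) (q : Index n) :
    u q ≤ t := by
  have h := q.2
  refine (le_pattern hu q ⟨q.1.1 - 1, by omega⟩ (by simp; omega)).trans ?_
  unfold grassmannPattern
  split_ifs <;> linarith

theorem coord_eq_zero (ht : 0 < t) (hu : u ∈ gcPolytope (grassmannPattern 2 n t)) {q : Index n}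
    (hq : 3 ≤ q.1.1) : u q = 0 := by
  have h := q.2
  refine le_antisymm ?_ (coord_nonneg ht hu q)
  refine (le_pattern hu q ⟨q.1.1 - 1, by omega⟩ (by simp; omega)).trans ?_
  unfold grassmannPattern
  simp only
  rw [if_neg (by omega)]

theorem top_zero (u : Index n → ℝ) : top u 0 = 0 := by simp [top]

theorem second_zero (u : Index n → ℝ) : second u 0 = 0 := by simp [second]

theorem second_one (u : Index n → ℝ) : second u 1 = 0 := by simp [second]

theorem top_nonneg (ht : 0 < t) (hu : u ∈ gcPolytope (grassmannPattern 2 n t)) (j : ℕ) :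
    0 ≤ top u j := by
  unfold top
  split_ifs
  · exact coord_nonneg ht hu _
  · rfl

theorem second_nonneg (ht : 0 < t) (hu : u ∈ gcPolytope (grassmannPattern 2 n t)) (j : ℕ) :
    0 ≤ second u j := by
  unfold second
  split_ifs
  · exact coord_nonneg ht hu _
  · rfl

theorem top_le (ht : 0 < t) (hu : u ∈ gcPolytope (grassmannPattern 2 n t)) (j : ℕ) :
    top u j ≤ t := by
  unfold top
  split_ifs
  · exact coord_le ht hu _
  · exact ht.le

/-- The top coordinate is squeezed between the two eigenvalues `t` already at `j = n - 1`. This is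
why `IsDegenerate` stops at `j + 2 ≤ n`. -/
theorem top_eq_of_le (hn : 2 ≤ n) (ht : 0 < t) (hu : u ∈ gcPolytope (grassmannPattern 2 n t))
    {j : ℕ} (h1 : n ≤ j + 1) (h2 : j ≤ n) : top u j = t := by
  refine le_antisymm (top_le ht hu j) ?_
  rw [top, dif_pos (by omega)]
  refine le_trans ?_ (pattern_le hu _ ⟨n - j, by omega⟩ (by simp; omega))
  unfold grassmannPattern
  simp only
  rw [if_pos (by omega)]

theorem second_self (hn : 2 ≤ n) (hu : u ∈ gcPolytope (grassmannPattern 2 n t)) :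
    second u n = t := by
  rw [second, dif_pos (by omega), hu.1 _ ⟨1, by omega⟩ (by simp; omega) rfl]
  simp [grassmannPattern]

theorem top_mono (ht : 0 < t) (hu : u ∈ gcPolytope (grassmannPattern 2 n t)) {j : ℕ}
    (hj : j < n) : top u j ≤ top u (j + 1) := by
  by_cases h : 1 ≤ j
  · rw [top, top, dif_pos (by omega), dif_pos (by omega)]
    exact hu.2.1 _ _ rfl rfl
  · obtain rfl : j = 0 := by omega
    rw [top_zero]
    exact top_nonneg ht hu _

theorem second_mono (ht : 0 < t) (hu : u ∈ gcPolytope (grassmannPattern 2 n t)) {j : ℕ}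
    (hj : j < n) : second u j ≤ second u (j + 1) := by
  by_cases h : 2 ≤ j
  · rw [second, second, dif_pos (by omega), dif_pos (by omega)]
    exact hu.2.1 _ _ rfl (by simp; omega)
  · rw [second, dif_neg (by omega)]
    exact second_nonneg ht hu _

theorem second_succ_le_top (hu : u ∈ gcPolytope (grassmannPattern 2 n t)) {j : ℕ} (hj : j < n) :
    second u (j + 1) ≤ top u j := by
  by_cases h : 1 ≤ j
  · rw [second, top, dif_pos (by omega), dif_pos (by omega)]
    exact hu.2.2 _ _ rfl (by simp)
  · obtain rfl : j = 0 := by omega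
    rw [top_zero, zero_add, second_one]

theorem second_le_top (ht : 0 < t) (hu : u ∈ gcPolytope (grassmannPattern 2 n t)) {j : ℕ}
    (hj : j ≤ n) : second u j ≤ top u j := by
  cases j with
  | zero => rw [second_zero, top_zero]
  | succ j => exact (second_succ_le_top hu (by omega)).trans (top_mono ht hu (by omega))

end Frames

/-! ### Gelfand–Cetlin coordinates in terms of frames -/

section Coordinates

open Matrix Polynomial

/-- A non-increasing list is determined by its multiset, here the roots of the characteristic
polynomial. -/
theorem Matrix.IsHermitian.eigenvalues₀_eq_iff {j : ℕ} {y : Mat j} (hy : y.IsHermitian)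
    {ev : ℕ → ℝ} (hev : Antitone ev) :
    (∀ k, hy.eigenvalues₀ k = ev k) ↔
      y.charpoly = ∏ k ∈ Finset.range j, (X - C (ev k : ℂ)) := by
  constructor
  · intro h
    have hprod := Equiv.prod_comp (Fintype.equivOfCardEq (β := Fin j) (Fintype.card_fin _)).symm
      fun k : Fin (Fintype.card (Fin j)) => X - C (ev k : ℂ)
    rw [Fin.prod_univ_eq_prod_range (fun k => X - C (ev k : ℂ))] at hprod
    have hrange : Finset.range j = Finset.range (Fintype.card (Fin j)) := by rw [Fintype.card_fin]
    rw [hy.charpoly_eq, hrange, ← hprod]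
    refine Finset.prod_congr rfl fun i _ => ?_
    rw [IsHermitian.eigenvalues, h]
    rfl
  · intro h k
    have h1 := hy.sort_roots_charpoly_eq_eigenvalues₀
    have hroots : y.charpoly.roots = (Multiset.range j).map fun k => (ev k : ℂ) := by
      rw [h, roots_prod _ _ (Finset.prod_ne_zero_iff.mpr fun k _ => X_sub_C_ne_zero _)]
      simp only [roots_X_sub_C, Multiset.bind_singleton]
      rfl
    have h2 : (List.range j).map ev = List.ofFn hy.eigenvalues₀ := by
      rw [← h1, hroots, Multiset.map_map]
      refine List.Perm.eq_of_sortedGE ?_ ?_ ?_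
      · rw [List.sortedGE_iff_getElem_ge_getElem_of_le]
        intro a b ha hb hab
        simpa using hev hab
      · exact (Multiset.pairwise_sort _ _).sortedGE
      · rw [← Multiset.coe_eq_coe, Multiset.sort_eq]
        simp [Multiset.range, Function.comp_def]
    have hk : (k : ℕ) < j := by simpa using k.2
    have h3 := List.getElem_of_eq h2 (i := k) (by simpa using hk)
    rw [List.getElem_ofFn] at h3
    simpa using h3.symm

/-- The matrix `A` with the rows from the `j`-th on replaced by zero. -/
def firstRows {n : ℕ} (A : Matrix (Fin n) (Fin 2) ℂ) (j : ℕ) : Matrix (Fin n) (Fin 2) ℂ :=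
  Matrix.of fun i c => if (i : ℕ) < j then A i c else 0

/-- The Gram matrix of the two columns of the first `j` rows of `A`. -/
def frameGram {n : ℕ} (A : Matrix (Fin n) (Fin 2) ℂ) (j : ℕ) : Matrix (Fin 2) (Fin 2) ℂ :=
  (firstRows A j)ᴴ * firstRows A j

theorem sum_fin_ite_lt {M : Type*} [AddCommMonoid M] {n j : ℕ} (hj : j ≤ n) (f : Fin n → M) :
    ∑ i : Fin n, (if (i : ℕ) < j then f i else 0) = ∑ i : Fin j, f (Fin.castLE hj i) := by
  rw [← Finset.sum_filter]
  refine (Finset.sum_bij (fun (i : Fin j) _ => Fin.castLE hj i) ?_ ?_ ?_ ?_).symm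
  · simp
  · simp
  · intro i hi
    simp only [Finset.mem_filter_univ] at hi
    exact ⟨⟨i, hi⟩, Finset.mem_univ _, rfl⟩
  · simp

theorem frameGram_apply {n : ℕ} (A : Matrix (Fin n) (Fin 2) ℂ) {j : ℕ} (hj : j ≤ n) (a b : Fin 2) :
    frameGram A j a b = ∑ i : Fin j, star (A (Fin.castLE hj i) a) * A (Fin.castLE hj i) b := by
  rw [← sum_fin_ite_lt hj fun i => star (A i a) * A i b, frameGram, mul_apply]
  refine Finset.sum_congr rfl fun i _ => ?_
  simp only [conjTranspose_apply, firstRows, of_apply]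
  split_ifs <;> simp

/-- `B * Bᴴ` and `Bᴴ * B` have the same characteristic polynomial up to powers of `X`. Placing
powers on both sides covers `j < 2` as well. -/
theorem charpoly_submatrix_frame {n : ℕ} (A : Matrix (Fin n) (Fin 2) ℂ) {j : ℕ} (hj : j ≤ n) :
    ((A * Aᴴ).submatrix (Fin.castLE hj) (Fin.castLE hj)).charpoly * X ^ 2 =
      (frameGram A j).charpoly * X ^ j := by
  have h1 : (A * Aᴴ).submatrix (Fin.castLE hj) (Fin.castLE hj) =
      A.submatrix (Fin.castLE hj) id * (A.submatrix (Fin.castLE hj) id)ᴴ := by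
    ext i k
    simp [mul_apply]
  have h2 : frameGram A j = (A.submatrix (Fin.castLE hj) id)ᴴ * A.submatrix (Fin.castLE hj) id := by
    ext a b
    rw [frameGram_apply A hj]
    simp [mul_apply]
  have h := charpoly_mul_comm' (A.submatrix (Fin.castLE hj) id) (A.submatrix (Fin.castLE hj) id)ᴴ
  rw [h1, h2, mul_comm, mul_comm _ (X ^ j)]
  simpa using h

theorem charpoly_eq_iff_trace_det (B : Matrix (Fin 2) (Fin 2) ℂ) (a b : ℂ) :
    B.charpoly = (X - C a) * (X - C b) ↔ B.trace = a + b ∧ B.det = a * b := by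
  rw [charpoly_fin_two]
  have e : (X - C a) * (X - C b) = X ^ 2 - C (a + b) * X + C (a * b) := by
    simp only [C_add, C_mul]
    ring
  rw [e]
  constructor
  · intro h
    have h0 := congrArg (fun q => q.coeff 0) h
    have h1 := congrArg (fun q => q.coeff 1) h
    simp [coeff_X] at h0 h1
    exact ⟨by linear_combination -h1, h0⟩
  · rintro ⟨h1, h2⟩
    rw [h1, h2]

/-- The eigenvalues of the leading `j × j` submatrix prescribed by `u`. -/
noncomputable def prescribed {n : ℕ} (u : Index n → ℝ) (j k : ℕ) : ℝ :=
  if k = 0 then top u j else if k = 1 then second u j else 0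

variable {n : ℕ} {t : ℝ} {u : Index n → ℝ}

theorem prescribed_antitone (ht : 0 < t) (hu : u ∈ gcPolytope (grassmannPattern 2 n t)) {j : ℕ}
    (hj : j ≤ n) : Antitone (prescribed u j) := by
  have h1 := second_le_top ht hu hj
  have h2 := second_nonneg ht hu j
  intro k l hkl
  unfold prescribed
  split_ifs <;> first | omega | linarith

theorem prod_prescribed (u : Index n → ℝ) {j : ℕ} (hj : 1 ≤ j) :
    (∏ k ∈ Finset.range j, (X - C (prescribed u j k : ℂ))) * X ^ 2 =
      (X - C (top u j : ℂ)) * (X - C (second u j : ℂ)) * X ^ j := by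
  obtain ⟨j, rfl⟩ : ∃ m, j = m + 1 := ⟨j - 1, by omega⟩
  rw [Finset.prod_range_succ']
  cases j with
  | zero => simp [prescribed, second_one]; ring
  | succ j =>
    rw [Finset.prod_range_succ']
    simp [prescribed]
    ring

theorem gcMap_apply {lam : Fin n → ℝ} (x : orbit lam) (q : Index n) {m : ℕ} (hm : m ≤ n)
    (hq : q.1.1 + q.1.2 = m + 1) :
    gcMap x q = ((orbit_isHermitian x).submatrix (Fin.castLE hm)).eigenvalues₀
      ⟨q.1.1 - 1, by have := q.2; rw [Fintype.card_fin]; omega⟩ := by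
  obtain rfl : m = q.1.1 + q.1.2 - 1 := by omega
  rfl

theorem coord_eq_prescribed (ht : 0 < t) (hu : u ∈ gcPolytope (grassmannPattern 2 n t))
    (q : Index n) : u q = prescribed u (q.1.1 + q.1.2 - 1) (q.1.1 - 1) := by
  have h := q.2
  unfold prescribed
  split_ifs with h1 h2
  · rw [top_eq u (by omega : q.1.1 = 1)]
    congr 1
    omega
  · rw [second_eq u (by omega : q.1.1 = 2)]
    congr 1
    omega
  · exact coord_eq_zero ht hu (by omega)

theorem gcMap_eq_iff_eigenvalues (ht : 0 < t) (hu : u ∈ gcPolytope (grassmannPattern 2 n t))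
    (x : orbit (grassmannPattern 2 n t)) :
    gcMap x = u ↔ ∀ j, 1 ≤ j → ∀ hj : j ≤ n, ∀ k,
      ((orbit_isHermitian x).submatrix (Fin.castLE hj)).eigenvalues₀ k = prescribed u j k := by
  constructor
  · rintro rfl j hj1 hj k
    have hk : (k : ℕ) < j := by simpa using k.2
    have h := gcMap_apply x ⟨(k + 1, j - k), by omega, by omega, by simp; omega⟩ hj
      (by simp; omega)
    rw [coord_eq_prescribed ht hu] at h
    simp only [Nat.add_sub_cancel, Fin.eta] at h
    rw [← h]
    congr 1
    omega
  · intro h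
    funext q
    have hq := q.2
    rw [gcMap_apply x q (m := q.1.1 + q.1.2 - 1) (by omega) (by omega), h _ (by omega),
      ← coord_eq_prescribed ht hu]

theorem gcMap_eq_iff_charpoly (ht : 0 < t) (hu : u ∈ gcPolytope (grassmannPattern 2 n t))
    (x : orbit (grassmannPattern 2 n t)) :
    gcMap x = u ↔ ∀ j, 1 ≤ j → ∀ hj : j ≤ n,
      ((x : Mat n).submatrix (Fin.castLE hj) (Fin.castLE hj)).charpoly =
        ∏ k ∈ Finset.range j, (X - C (prescribed u j k : ℂ)) := by
  rw [gcMap_eq_iff_eigenvalues ht hu]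
  refine forall_congr' fun j => forall_congr' fun _ => forall_congr' fun hj => ?_
  exact Matrix.IsHermitian.eigenvalues₀_eq_iff _ (prescribed_antitone ht hu hj)

theorem gcMap_eq_iff_gram (ht : 0 < t) (hu : u ∈ gcPolytope (grassmannPattern 2 n t))
    (x : orbit (grassmannPattern 2 n t)) {A : Matrix (Fin n) (Fin 2) ℂ}
    (hx : (x : Mat n) = A * Aᴴ) :
    gcMap x = u ↔ ∀ j, 1 ≤ j → j ≤ n →
      (frameGram A j).trace = (top u j : ℂ) + (second u j : ℂ) ∧
        (frameGram A j).det = (top u j : ℂ) * (second u j : ℂ) := by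
  rw [gcMap_eq_iff_charpoly ht hu, hx]
  refine forall_congr' fun j => forall_congr' fun h1 => forall_congr' fun hj => ?_
  rw [← charpoly_eq_iff_trace_det, ← mul_left_inj' (pow_ne_zero 2 X_ne_zero),
    prod_prescribed u h1, charpoly_submatrix_frame A hj,
    mul_left_inj' (pow_ne_zero j X_ne_zero)]

/-- The values of the characteristic polynomials at each `z` depend continuously on `x`, so no
continuity of eigenvalues is needed. -/
theorem isClosed_gcFiber (ht : 0 < t) (hu : u ∈ gcPolytope (grassmannPattern 2 n t)) :
    IsClosed (gcFiber (grassmannPattern 2 n t) u) := by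
  have h : gcFiber (grassmannPattern 2 n t) u =
      {x : orbit (grassmannPattern 2 n t) | ∀ j, 1 ≤ j → ∀ (hj : j ≤ n) (z : ℂ),
        (((x : Mat n).submatrix (Fin.castLE hj) (Fin.castLE hj)).charpoly).eval z =
        (∏ k ∈ Finset.range j, (X - C (prescribed u j k : ℂ))).eval z} := by
    ext x
    simp only [gcFiber, Set.mem_ofPred_eq, gcMap_eq_iff_charpoly ht hu]
    refine forall_congr' fun j => forall_congr' fun h1 => forall_congr' fun hj => ?_
    exact ⟨fun h z => by rw [h], fun h => Polynomial.funext h⟩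
  rw [h]
  simp only [Set.ofPred_forall, eval_charpoly]
  refine isClosed_iInter fun j => isClosed_iInter fun _ => isClosed_iInter fun hj =>
    isClosed_iInter fun z => isClosed_eq ?_ continuous_const
  fun_prop

end Coordinates

/-! ### The polygon of a frame -/

section FramePolygon

set_option linter.unusedSectionVars false

open Matrix

/-- The edge of the spatial polygon attached to the `i`-th row of a frame: the traceless part of
the Hermitian matrix of rank one given by this row. -/
noncomputable def bloch {n : ℕ} (A : Matrix (Fin n) (Fin 2) ℂ) (i : Fin n) : WithLp 2 (ℝ × ℂ) :=
  WithLp.toLp 2 (‖A i 0‖ ^ 2 - ‖A i 1‖ ^ 2, 2 * (star (A i 0) * A i 1))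

theorem norm_bloch {n : ℕ} (A : Matrix (Fin n) (Fin 2) ℂ) (i : Fin n) :
    ‖bloch A i‖ = ‖A i 0‖ ^ 2 + ‖A i 1‖ ^ 2 := by
  rw [← sq_eq_sq₀ (norm_nonneg _) (by positivity), WithLp.prod_norm_sq_eq_of_L2]
  simp only [bloch, WithLp.toLp_fst, WithLp.toLp_snd, norm_mul, norm_star, Real.norm_eq_abs,
    sq_abs, Complex.norm_ofNat]
  ring

theorem vertex_periodize_eq_sum {V : Type*} [NormedAddCommGroup V] {n : ℕ} [NeZero n]
    (e : Fin n → V) {j : ℕ} (hj : j ≤ n) :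
    vertex (periodize e) j = ∑ i : Fin j, e (Fin.castLE hj i) := by
  rw [vertex, ← Fin.sum_univ_eq_sum_range]
  refine Finset.sum_congr rfl fun i _ => ?_
  rw [periodize]
  congr 1
  ext
  simp [Nat.mod_eq_of_lt (lt_of_lt_of_le i.2 hj)]

theorem star_mul_self_eq (z : ℂ) : star z * z = ((‖z‖ ^ 2 : ℝ) : ℂ) := by
  rw [Complex.star_def, mul_comm, Complex.mul_conj, Complex.normSq_eq_norm_sq]

variable {n : ℕ} {t : ℝ}

theorem frameGram_diag (A : Matrix (Fin n) (Fin 2) ℂ) {j : ℕ} (hj : j ≤ n) (a : Fin 2) :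
    frameGram A j a a = ((∑ i : Fin j, ‖A (Fin.castLE hj i) a‖ ^ 2 : ℝ) : ℂ) := by
  rw [frameGram_apply A hj]
  push_cast
  exact Finset.sum_congr rfl fun i _ => by rw [star_mul_self_eq]; push_cast; rfl

theorem frameGram_conj (A : Matrix (Fin n) (Fin 2) ℂ) (j : ℕ) :
    frameGram A j 1 0 = star (frameGram A j 0 1) := by
  have h : (frameGram A j)ᴴ = frameGram A j := by simp [frameGram]
  rw [← conjTranspose_apply, h]

variable [NeZero n]

theorem sum_norm_bloch (A : Matrix (Fin n) (Fin 2) ℂ) {j : ℕ} (hj : j ≤ n) {a b : ℝ}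
    (htr : (frameGram A j).trace = (a : ℂ) + b) :
    ∑ i ∈ Finset.range j, ‖periodize (bloch A) i‖ = a + b := by
  have h : ∑ i ∈ Finset.range j, ‖periodize (bloch A) i‖ =
      ∑ i : Fin j, ‖bloch A (Fin.castLE hj i)‖ :=
    vertex_periodize_eq_sum (fun i => ‖bloch A i‖) hj
  rw [trace_fin_two, frameGram_diag A hj, frameGram_diag A hj] at htr
  rw [h, ← Complex.ofReal_inj, Complex.ofReal_add, ← htr, ← Complex.ofReal_add,
    ← Finset.sum_add_distrib]
  simp only [norm_bloch]

/-- The coordinates of the vertex give squared norm `tr² - 4 det` of the Gram matrix, the square of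
the eigenvalue gap. -/
theorem norm_vertex_bloch (A : Matrix (Fin n) (Fin 2) ℂ) {j : ℕ} (hj : j ≤ n) {a b : ℝ}
    (hab : b ≤ a) (htr : (frameGram A j).trace = (a : ℂ) + b)
    (hdet : (frameGram A j).det = (a : ℂ) * b) :
    ‖vertex (periodize (bloch A)) j‖ = a - b := by
  have h1 : (vertex (periodize (bloch A)) j).fst =
      ∑ i : Fin j, ‖A (Fin.castLE hj i) 0‖ ^ 2 - ∑ i : Fin j, ‖A (Fin.castLE hj i) 1‖ ^ 2 := by
    rw [vertex_periodize_eq_sum _ hj, ← WithLp.fstₗ_apply (p := 2) (𝕜 := ℝ), map_sum,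
      ← Finset.sum_sub_distrib]
    rfl
  have h2 : (vertex (periodize (bloch A)) j).snd = 2 * frameGram A j 0 1 := by
    rw [vertex_periodize_eq_sum _ hj, frameGram_apply A hj, Finset.mul_sum]
    rw [← WithLp.sndₗ_apply (p := 2) (𝕜 := ℝ), map_sum]
    rfl
  rw [trace_fin_two, frameGram_diag A hj, frameGram_diag A hj] at htr
  rw [det_fin_two, frameGram_diag A hj, frameGram_diag A hj, frameGram_conj, mul_comm (frameGram A j 0 1),
    star_mul_self_eq] at hdet
  rw [← sq_eq_sq₀ (norm_nonneg _) (by linarith), WithLp.prod_norm_sq_eq_of_L2, h1, h2, norm_mul,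
    Complex.norm_ofNat, Real.norm_eq_abs, sq_abs, mul_pow]
  norm_cast at htr hdet
  linear_combination (∑ i : Fin j, ‖A (Fin.castLE hj i) 0‖ ^ 2 +
    ∑ i : Fin j, ‖A (Fin.castLE hj i) 1‖ ^ 2 + a + b) * htr - 4 * hdet

variable {u : Index n → ℝ} {x : orbit (grassmannPattern 2 n t)} {A : Matrix (Fin n) (Fin 2) ℂ}

theorem frameGram_of_gcMap_eq (ht : 0 < t) (hu : u ∈ gcPolytope (grassmannPattern 2 n t))
    (hx : (x : Mat n) = A * Aᴴ) (hxu : gcMap x = u) {j : ℕ} (hj : j ≤ n) :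
    (frameGram A j).trace = (top u j : ℂ) + (second u j : ℂ) ∧
      (frameGram A j).det = (top u j : ℂ) * (second u j : ℂ) := by
  cases j with
  | zero =>
    have h : frameGram A 0 = 0 := by
      ext a b
      simp [frameGram_apply A (Nat.zero_le n)]
    simp [h, top_zero, second_zero]
  | succ j => exact (gcMap_eq_iff_gram ht hu x hx).mp hxu (j + 1) (by omega) hj

/-- Vertex norms are `top - second` and edge norms are increments of `top + second`, so each norm
equality becomes linear and collapses to one equality of coordinates. -/
theorem shape_of_gcMap_eq (ht : 0 < t) (hu : u ∈ gcPolytope (grassmannPattern 2 n t))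
    (hx : (x : Mat n) = A * Aᴴ) (hxu : gcMap x = u) {j : ℕ} (hj : j < n) :
    (Shrinks (periodize (bloch A)) j ↔ top u (j + 1) = top u j) ∧
    (Grows (periodize (bloch A)) j ↔ second u (j + 1) = second u j) ∧
    (Folds (periodize (bloch A)) j ↔ second u (j + 1) = top u j) := by
  obtain ⟨tr, det⟩ := frameGram_of_gcMap_eq ht hu hx hxu hj.le
  obtain ⟨tr', det'⟩ := frameGram_of_gcMap_eq ht hu hx hxu (j := j + 1) hj
  have v := norm_vertex_bloch A hj.le (second_le_top ht hu hj.le) tr det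
  have v' := norm_vertex_bloch A (j := j + 1) hj (second_le_top ht hu hj) tr' det'
  have s := sum_norm_bloch A hj.le tr
  have s' := sum_norm_bloch A (j := j + 1) hj tr'
  rw [Finset.sum_range_succ, s] at s'
  unfold Shrinks Grows Folds
  refine ⟨⟨fun h => ?_, fun h => ?_⟩, ⟨fun h => ?_, fun h => ?_⟩, ⟨fun h => ?_, fun h => ?_⟩⟩ <;>
  linarith

theorem sum_bloch_eq_zero (hA : Aᴴ * A = (t : ℂ) • 1) : ∑ i, bloch A i = 0 := by
  have h : frameGram A n = (t : ℂ) • 1 := by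
    rw [← hA, frameGram]
    congr 1 <;> ext <;> simp [firstRows]
  rw [← vertex_periodize_self, ← norm_eq_zero,
    norm_vertex_bloch A le_rfl (le_refl t) (by simp [h, mul_two]) (by simp [h, sq]),
    sub_self]

theorem bloch_ne_zero (ht : 0 < t) (hA : Aᴴ * A = (t : ℂ) • 1) : bloch A ≠ 0 := by
  intro h0
  have h : frameGram A n = (t : ℂ) • 1 := by
    rw [← hA, frameGram]
    congr 1 <;> ext <;> simp [firstRows]
  have hs := sum_norm_bloch A le_rfl (a := t) (b := t) (by simp [h, mul_two])
  simp [h0, periodize] at hs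
  linarith

theorem permAct_frame (w : Equiv.Perm (Fin n)) (hx : (x : Mat n) = A * Aᴴ) :
    ((permAct w x : orbit (grassmannPattern 2 n t)) : Mat n) =
      A.submatrix w id * (A.submatrix w id)ᴴ := by
  ext i k
  simp only [permAct, unitaryAct, hx, star_eq_conjTranspose, conjTranspose_permMatrix]
  simp [Equiv.Perm.permMatrix, PEquiv.toMatrix_toPEquiv_mul, mul_apply, Equiv.symm_apply_eq]

/-- `u` satisfies with equality one of the inequalities that are not forced on the polytope. -/
def IsDegenerate (u : Index n → ℝ) : Prop :=
  ∃ j, 1 ≤ j ∧ j + 2 ≤ n ∧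
    (top u (j + 1) = top u j ∨ second u (j + 1) = second u j ∨ second u (j + 1) = top u j)

/-! ### Equalities on the relative interior of a face -/

theorem exists_add_smul_sub_mem_of_mem_intrinsicInterior {E : Type*} [AddCommGroup E]
    [Module ℝ E] [TopologicalSpace E] [IsTopologicalAddGroup E] [ContinuousSMul ℝ E] {f : Set E} {u v : E} (hu : u ∈ intrinsicInterior ℝ f) (hv : v ∈ f) :
    ∃ s : ℝ, 0 < s ∧ u + s • (u - v) ∈ f := by
  obtain ⟨y, hy, rfl⟩ := hu
  have hmem : ∀ s : ℝ, (y : E) + s • ((y : E) - v) ∈ affineSpan ℝ f := by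
    intro s
    have h := AffineMap.lineMap_mem (-s) y.2 (subset_affineSpan ℝ f hv)
    convert h using 1
    rw [AffineMap.lineMap_apply_module']
    module
  let c : ℝ → affineSpan ℝ f := fun s => ⟨(y : E) + s • ((y : E) - v), hmem s⟩
  have hc : Continuous c := by
    apply Continuous.subtype_mk
    fun_prop
  have hc0 : c 0 = y := by
    apply Subtype.ext
    simp [c]
  have hev : ∀ᶠ s in nhds (0 : ℝ), c s ∈ interior (((↑) : affineSpan ℝ f → E) ⁻¹' f) :=
    hc.continuousAt.eventually_mem (by rw [hc0]; exact isOpen_interior.mem_nhds hy)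
  obtain ⟨s, hs, hpos⟩ := ((hev.filter_mono nhdsWithin_le_nhds).and
    (self_mem_nhdsWithin (s := Set.Ioi 0))).exists
  have hs' : c s ∈ (((↑) : affineSpan ℝ f → E) ⁻¹' f) := interior_subset hs
  exact ⟨s, hpos, hs'⟩

theorem top_add_smul_sub (u v : Index n → ℝ) (s : ℝ) (j : ℕ) :
    top (u + s • (u - v)) j = top u j + s * (top u j - top v j) := by
  unfold top
  split_ifs <;> simp

theorem second_add_smul_sub (u v : Index n → ℝ) (s : ℝ) (j : ℕ) :
    second (u + s • (u - v)) j = second u j + s * (second u j - second v j) := by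
  unfold second
  split_ifs <;> simp

/-- If an inequality were tight at `u` and strict at `v`, a small step past `u` away from `v` would
violate it. -/
theorem tight_of_mem_intrinsicInterior (ht : 0 < t) {f : Set (Index n → ℝ)}
    (hf : f ⊆ gcPolytope (grassmannPattern 2 n t)) {u v : Index n → ℝ}
    (hu : u ∈ intrinsicInterior ℝ f) (hv : v ∈ f) {j : ℕ} (hj : j < n) :
    (top u (j + 1) = top u j → top v (j + 1) = top v j) ∧
    (second u (j + 1) = second u j → second v (j + 1) = second v j) ∧
    (second u (j + 1) = top u j → second v (j + 1) = top v j) := by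
  obtain ⟨s, hs, hmem⟩ := exists_add_smul_sub_mem_of_mem_intrinsicInterior hu hv
  have a := top_mono ht (hf hmem) hj
  have b := second_mono ht (hf hmem) hj
  have c := second_succ_le_top (hf hmem) hj
  have a' := top_mono ht (hf hv) hj
  have b' := second_mono ht (hf hv) hj
  have c' := second_succ_le_top (hf hv) hj
  simp only [top_add_smul_sub, second_add_smul_sub] at a b c
  have key : ∀ {x y x' y' : ℝ}, x' ≤ y' → x + s * (x - x') ≤ y + s * (y - y') → y = x →
      y' = x' := by
    rintro x _ x' y' h1 h2 rfl
    have := le_of_mul_le_mul_left (add_le_add_iff_left _ |>.mp h2) hs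
    linarith
  exact ⟨key a' a, key b' b, fun h => (key c' c h.symm).symm⟩

/-- A subset of the polytope whose relative interior consists of degenerate points is displaced by
a permutation. -/
theorem exists_permDisplacesFace [Fact n.Prime] (ht : 0 < t) {f : Set (Index n → ℝ)}
    (hf : f ⊆ gcPolytope (grassmannPattern 2 n t))
    (hdeg : ∀ u ∈ intrinsicInterior ℝ f, IsDegenerate u) :
    ∃ w : Equiv.Perm (Fin n), PermDisplacesFace (grassmannPattern 2 n t) f w := by
  have hn : 2 ≤ n := (Fact.out : n.Prime).two_le
  by_cases hne : ∃ x : orbit (grassmannPattern 2 n t), gcMap x ∈ intrinsicInterior ℝ f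
  swap
  · refine ⟨1, isHamiltonianDiffeo_unitaryAct _, ?_⟩
    rw [Set.disjoint_right]
    exact fun x hx => absurd ⟨x, hx⟩ hne
  obtain ⟨x₀, hx₀⟩ := hne
  obtain ⟨A₀, hA₀, hxA₀⟩ := exists_frame hn ht x₀
  have hshape : ∀ (x : orbit (grassmannPattern 2 n t)) (A : Matrix (Fin n) (Fin 2) ℂ),
      (x : Mat n) = A * Aᴴ → gcMap x ∈ intrinsicInterior ℝ f →
      SameShape n (periodize (bloch A)) (periodize (bloch A₀)) := by
    intro x A hxA hx j hj
    obtain ⟨a, b, c⟩ := shape_of_gcMap_eq ht (hf (intrinsicInterior_subset hx)) hxA rfl hj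
    obtain ⟨a₀, b₀, c₀⟩ := shape_of_gcMap_eq ht (hf (intrinsicInterior_subset hx₀)) hxA₀ rfl hj
    obtain ⟨l1, l2, l3⟩ :=
      tight_of_mem_intrinsicInterior ht hf hx (intrinsicInterior_subset hx₀) hj
    obtain ⟨r1, r2, r3⟩ :=
      tight_of_mem_intrinsicInterior ht hf hx₀ (intrinsicInterior_subset hx) hj
    rw [a, b, c, a₀, b₀, c₀]
    exact ⟨⟨l1, r1⟩, ⟨l2, r2⟩, ⟨l3, r3⟩⟩
  obtain ⟨w, hw⟩ := exists_perm_not_sameShape (sum_bloch_eq_zero hA₀) (bloch_ne_zero ht hA₀) (by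
    obtain ⟨j, hj1, hj2, h⟩ := hdeg _ hx₀
    obtain ⟨a, b, c⟩ := shape_of_gcMap_eq ht (hf (intrinsicInterior_subset hx₀)) hxA₀ rfl
      (j := j) (by omega)
    exact ⟨j, hj1, hj2, by rwa [IsFlat, a, b, c]⟩)
  refine ⟨w, isHamiltonianDiffeo_unitaryAct _, ?_⟩
  rw [Set.disjoint_left]
  rintro _ ⟨x, hx, rfl⟩ hwx
  obtain ⟨A, hA, hxA⟩ := exists_frame hn ht x
  exact hw (bloch A) (sum_bloch_eq_zero hA) (hshape x A hxA hx)
    (hshape _ _ (permAct_frame w hxA) hwx)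

theorem isDisplaceable_of_permDisplacesFace (ht : 0 < t) {f : Set (Index n → ℝ)}
    (hf : f ⊆ gcPolytope (grassmannPattern 2 n t)) {w : Equiv.Perm (Fin n)}
    (hw : PermDisplacesFace (grassmannPattern 2 n t) f w) :
    IsDisplaceableFace (grassmannPattern 2 n t) f := by
  intro u hu
  refine ⟨_, hw.1, ?_⟩
  rw [(isClosed_gcFiber ht (hf (intrinsicInterior_subset hu))).closure_eq]
  have hsub : gcFiber (grassmannPattern 2 n t) u ⊆ gcMap ⁻¹' intrinsicInterior ℝ f := by
    rintro x rfl
    exact hu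
  exact hw.2.mono (Set.image_mono hsub) hsub

end FramePolygon

/-! ### Proper faces -/

section ProperFaces

variable {n : ℕ} {t : ℝ} {u : Index n → ℝ}

instance GelfandCetlin.Index.finite : Finite (Index n) := by
  refine Set.Finite.subset ((Set.finite_Iic n).prod (Set.finite_Iic n)) ?_
  rintro ⟨i, j⟩ ⟨h1, h2, h3⟩
  simp only at h1 h2 h3
  simp only [Set.mem_prod, Set.mem_Iic]
  omega

theorem lt_of_not_isDegenerate (ht : 0 < t) (hu : u ∈ gcPolytope (grassmannPattern 2 n t))
    (hd : ¬ IsDegenerate u) {j : ℕ} (h1 : 1 ≤ j) (h2 : j + 2 ≤ n) :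
    top u j < top u (j + 1) ∧ second u j < second u (j + 1) ∧ second u (j + 1) < top u j := by
  have h : ¬ (top u (j + 1) = top u j ∨ second u (j + 1) = second u j ∨
    second u (j + 1) = top u j) := fun h => hd ⟨j, h1, h2, h⟩
  push Not at h
  exact ⟨lt_of_le_of_ne (top_mono ht hu (by omega)) h.1.symm,
    lt_of_le_of_ne (second_mono ht hu (by omega)) h.2.1.symm,
    lt_of_le_of_ne (second_succ_le_top hu (by omega)) h.2.2⟩

theorem second_lt_of_not_isDegenerate (ht : 0 < t)
    (hu : u ∈ gcPolytope (grassmannPattern 2 n t)) (hd : ¬ IsDegenerate u) {j : ℕ} (h1 : 1 ≤ j)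
    (h2 : j < n) : second u j < t := by
  by_cases hj : j = 1
  · subst hj
    rwa [second_one]
  · obtain ⟨i, rfl⟩ : ∃ i, j = i + 1 := ⟨j - 1, by omega⟩
    exact (lt_of_not_isDegenerate ht hu hd (by omega) (by omega)).2.2.trans_le (top_le ht hu _)

theorem second_lt_top_of_not_isDegenerate (ht : 0 < t)
    (hu : u ∈ gcPolytope (grassmannPattern 2 n t)) (hd : ¬ IsDegenerate u) {j : ℕ} (h1 : 1 ≤ j)
    (h2 : j < n) : second u j < top u j := by
  by_cases hj : j + 2 ≤ n
  · obtain ⟨-, b, c⟩ := lt_of_not_isDegenerate ht hu hd h1 hj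
    exact b.trans c
  · rw [top_eq_of_le (by omega) ht hu (by omega) (by omega)]
    exact second_lt_of_not_isDegenerate ht hu hd h1 h2

/-- Each defining inequality is either strict at a nondegenerate point or an identity on the
polytope; the identities come from the frozen entries `t` and `0`. -/
theorem lt_or_eq_of_row (hn : 2 ≤ n) (ht : 0 < t) (hu : u ∈ gcPolytope (grassmannPattern 2 n t))
    (hd : ¬ IsDegenerate u) {q q' : Index n} (h1 : q'.1.1 = q.1.1) (h2 : q'.1.2 = q.1.2 + 1) :
    u q < u q' ∨ ∀ v ∈ gcPolytope (grassmannPattern 2 n t), v q = v q' := by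
  have hq := q.2
  have hq' := q'.2
  by_cases c1 : q.1.1 = 1
  · by_cases hj : q.1.2 + 2 ≤ n
    · left
      rw [top_eq u c1, top_eq u (h1.trans c1), h2]
      exact (lt_of_not_isDegenerate ht hu hd (by omega) hj).1
    · right
      intro v hv
      rw [top_eq v c1, top_eq v (h1.trans c1), top_eq_of_le hn ht hv (by omega) (by omega),
        top_eq_of_le hn ht hv (by omega) (by omega)]
  by_cases c2 : q.1.1 = 2
  · left
    rw [second_eq u c2, second_eq u (h1.trans c2), h2]
    by_cases hj : q.1.2 + 3 ≤ n
    · exact (lt_of_not_isDegenerate ht hu hd (by omega) (by omega)).2.1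
    · rw [show q.1.2 + 1 + 1 = n by omega, second_self hn hu]
      exact second_lt_of_not_isDegenerate ht hu hd (by omega) (by omega)
  · right
    intro v hv
    rw [coord_eq_zero ht hv (by omega), coord_eq_zero ht hv (by omega)]

theorem lt_or_eq_of_column (hn : 2 ≤ n) (ht : 0 < t)
    (hu : u ∈ gcPolytope (grassmannPattern 2 n t)) (hd : ¬ IsDegenerate u) {q q' : Index n}
    (h1 : q'.1.1 = q.1.1 + 1) (h2 : q'.1.2 = q.1.2) :
    u q' < u q ∨ ∀ v ∈ gcPolytope (grassmannPattern 2 n t), v q = v q' := by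
  have hq := q.2
  have hq' := q'.2
  by_cases c1 : q.1.1 = 1
  · rw [top_eq u c1, second_eq u (by omega : q'.1.1 = 2), h2]
    by_cases hj : q.1.2 + 2 ≤ n
    · left
      exact (lt_of_not_isDegenerate ht hu hd (by omega) hj).2.2
    · right
      intro v hv
      rw [top_eq v c1, second_eq v (by omega : q'.1.1 = 2), h2,
        top_eq_of_le hn ht hv (by omega) (by omega), show q.1.2 + 1 = n by omega,
        second_self hn hv]
  by_cases c2 : q.1.1 = 2
  · left
    rw [second_eq u c2, coord_eq_zero ht hu (by omega : 3 ≤ q'.1.1)]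
    exact (second_nonneg ht hu _).trans_lt
      (lt_of_not_isDegenerate ht hu hd (by omega) (by omega)).2.1
  · right
    intro v hv
    rw [coord_eq_zero ht hv (by omega), coord_eq_zero ht hv (by omega)]

theorem eventually_add_smul_le {a b c d : ℝ} (h : a < b ∨ c = d ∧ a = b) :
    ∀ᶠ s in nhdsWithin (0 : ℝ) (Set.Ioi 0), a + s * (a - c) ≤ b + s * (b - d) := by
  rcases h with h | ⟨rfl, rfl⟩
  · refine Filter.Eventually.filter_mono nhdsWithin_le_nhds ?_
    have h1 : ContinuousAt (fun s : ℝ => a + s * (a - c)) 0 := by fun_prop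
    have h2 : ContinuousAt (fun s : ℝ => b + s * (b - d)) 0 := by fun_prop
    exact (h1.eventually_lt h2 (by simpa using h)).mono fun s hs => hs.le
  · exact Filter.Eventually.of_forall fun s => le_rfl

theorem exists_add_smul_sub_mem_of_not_isDegenerate (hn : 2 ≤ n) (ht : 0 < t)
    (hu : u ∈ gcPolytope (grassmannPattern 2 n t)) (hd : ¬ IsDegenerate u) {v : Index n → ℝ}
    (hv : v ∈ gcPolytope (grassmannPattern 2 n t)) :
    ∃ s : ℝ, 0 < s ∧ u + s • (u - v) ∈ gcPolytope (grassmannPattern 2 n t) := by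
  have hrow : ∀ᶠ s in nhdsWithin (0 : ℝ) (Set.Ioi 0), ∀ q q' : Index n, q'.1.1 = q.1.1 →
      q'.1.2 = q.1.2 + 1 → u q + s * (u q - v q) ≤ u q' + s * (u q' - v q') := by
    simp only [Filter.eventually_all]
    intro q q' h1 h2
    exact eventually_add_smul_le ((lt_or_eq_of_row hn ht hu hd h1 h2).imp_right
      fun h => ⟨h v hv, h u hu⟩)
  have hcol : ∀ᶠ s in nhdsWithin (0 : ℝ) (Set.Ioi 0), ∀ q q' : Index n, q'.1.1 = q.1.1 + 1 →
      q'.1.2 = q.1.2 → u q' + s * (u q' - v q') ≤ u q + s * (u q - v q) := by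
    simp only [Filter.eventually_all]
    intro q q' h1 h2
    exact eventually_add_smul_le ((lt_or_eq_of_column hn ht hu hd h1 h2).imp_right
      fun h => ⟨(h v hv).symm, (h u hu).symm⟩)
  obtain ⟨s, ⟨hr, hc⟩, hs⟩ := ((hrow.and hcol).and (self_mem_nhdsWithin (s := Set.Ioi 0))).exists
  refine ⟨s, hs, fun q i h1 h2 => ?_, hr, hc⟩
  simp [hu.1 q i h1 h2, hv.1 q i h1 h2]

/-- From a nondegenerate `u` one can move a little away from any `v`. A functional maximal at `u` is
then at least as large at `v`, so its face is everything. -/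
theorem isDegenerate_of_isProperFace (hn : 2 ≤ n) (ht : 0 < t) {f : Set (Index n → ℝ)}
    (hf : IsProperFace (grassmannPattern 2 n t) f) {u : Index n → ℝ} (hu : u ∈ f) :
    IsDegenerate u := by
  by_contra hd
  obtain ⟨hne, hexp, hproper⟩ := hf
  obtain ⟨l, hl⟩ := hexp hne
  rw [hl] at hu
  refine hproper (Set.Subset.antisymm hexp.subset fun v hv => ?_)
  obtain ⟨s, hs, hmem⟩ := exists_add_smul_sub_mem_of_not_isDegenerate hn ht hu.1 hd hv
  have h := hu.2 _ hmem
  rw [map_add, map_smul, map_sub, smul_eq_mul] at h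
  have h' : l u ≤ l v := by
    by_contra hlt
    push Not at hlt
    have := mul_pos hs (sub_pos.mpr hlt)
    linarith
  rw [hl]
  exact ⟨hv, fun y hy => (hu.2 y hy).trans h'⟩

theorem isDegenerate_of_mem_squareFace {I : Finset ℕ} (hI : IsSquareSequence 2 n I)
    (hu : u ∈ squareFace 2 n t I) : IsDegenerate u := by
  obtain ⟨i, hi⟩ := hI.1
  obtain ⟨h1, h2⟩ := hI.2.1 i hi
  refine ⟨i - 1, by omega, by omega, Or.inl ?_⟩
  rw [top, top, dif_pos (by omega), dif_pos (by omega)]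
  exact hu.2 i hi _ _ (by simp; omega) (by simp; omega)

end ProperFaces

/-! ### Building frames row by row -/

section Tower

open Matrix

variable {n : ℕ}

/-- The matrix whose only nonzero row is the `j`-th one, which is `v`. -/
def rowAt (n j : ℕ) (v : Fin 2 → ℂ) : Matrix (Fin n) (Fin 2) ℂ :=
  Matrix.of fun i c => if (i : ℕ) = j then v c else 0

theorem rowAt_mul (j : ℕ) (v : Fin 2 → ℂ) (W : Matrix (Fin 2) (Fin 2) ℂ) :
    rowAt n j v * W = rowAt n j (v ᵥ* W) := by
  ext i c
  simp only [mul_apply, rowAt, of_apply, vecMul, dotProduct, ite_mul, zero_mul]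
  split_ifs <;> simp

theorem firstRows_mul (A : Matrix (Fin n) (Fin 2) ℂ) (j : ℕ) (W : Matrix (Fin 2) (Fin 2) ℂ) :
    firstRows (A * W) j = firstRows A j * W := by
  ext i c
  simp only [mul_apply, firstRows, of_apply, ite_mul, zero_mul]
  split_ifs <;> simp

theorem firstRows_self (A : Matrix (Fin n) (Fin 2) ℂ) : firstRows A n = A := by
  ext i c
  simp [firstRows]

theorem firstRows_zero (A : Matrix (Fin n) (Fin 2) ℂ) : firstRows A 0 = 0 := by
  ext i c
  simp [firstRows]

theorem firstRows_succ (A : Matrix (Fin n) (Fin 2) ℂ) {j : ℕ} (hj : j < n) :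
    firstRows A (j + 1) = firstRows A j + rowAt n j (A ⟨j, hj⟩) := by
  ext i c
  simp only [firstRows, rowAt, of_apply, Matrix.add_apply]
  rcases lt_trichotomy (i : ℕ) j with h | h | h
  · rw [if_pos (by omega), if_pos h, if_neg (by omega), add_zero]
  · rw [if_pos (by omega), if_neg (by omega), if_pos h, zero_add]
    congr 1
    exact Fin.ext h
  · rw [if_neg (by omega), if_neg (by omega), if_neg (by omega), add_zero]

theorem firstRows_add (A B : Matrix (Fin n) (Fin 2) ℂ) (j : ℕ) :
    firstRows (A + B) j = firstRows A j + firstRows B j := by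
  ext i c
  simp only [firstRows, of_apply, Matrix.add_apply]
  split_ifs <;> simp

theorem firstRows_rowAt {j k : ℕ} (hjk : j ≤ k) (v : Fin 2 → ℂ) :
    firstRows (rowAt n k v) j = 0 := by
  ext i c
  simp only [firstRows, of_apply, rowAt, Matrix.zero_apply]
  split_ifs <;> first | omega | rfl

theorem firstRows_add_rowAt_succ {A : Matrix (Fin n) (Fin 2) ℂ} {j : ℕ} (hA : firstRows A j = A)
    (v : Fin 2 → ℂ) : firstRows (A + rowAt n j v) (j + 1) = A + rowAt n j v := by
  ext i c
  have h := congrFun (congrFun hA i) c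
  simp only [firstRows, of_apply, rowAt, Matrix.add_apply] at h ⊢
  split_ifs at h ⊢ <;> first | omega | rfl | simp [← h]

theorem firstRows_apply_eq_zero {A : Matrix (Fin n) (Fin 2) ℂ} {j : ℕ} (hA : firstRows A j = A)
    {i : Fin n} (hi : j ≤ i) (c : Fin 2) : A i c = 0 := by
  rw [← hA, firstRows, of_apply, if_neg (by omega)]

theorem gram_add_rowAt {A : Matrix (Fin n) (Fin 2) ℂ} {j : ℕ} (hj : j < n)
    (hA : firstRows A j = A) (v : Fin 2 → ℂ) :
    (A + rowAt n j v)ᴴ * (A + rowAt n j v) = Aᴴ * A + vecMulVec (star v) v := by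
  ext a b
  have key : ∀ i : Fin n, star ((A + rowAt n j v) i a) * (A + rowAt n j v) i b =
      star (A i a) * A i b + if i = ⟨j, hj⟩ then star (v a) * v b else 0 := by
    intro i
    simp only [Matrix.add_apply, rowAt, of_apply, Fin.ext_iff]
    split_ifs with h
    · rw [firstRows_apply_eq_zero hA h.ge a, firstRows_apply_eq_zero hA h.ge b]
      simp
    · simp
  simp only [mul_apply, conjTranspose_apply, Matrix.add_apply (Aᴴ * A), vecMulVec_apply, key,
    Finset.sum_add_distrib, Finset.sum_ite_eq', Finset.mem_univ, if_true, Pi.star_apply]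

theorem exists_unitary_diagonalizing {B : Matrix (Fin 2) (Fin 2) ℂ} (hB : B.IsHermitian)
    {m : Fin 2 → ℝ} (htr : B.trace = (m 0 : ℂ) + m 1) (hdet : B.det = (m 0 : ℂ) * m 1) :
    ∃ R ∈ Matrix.unitaryGroup (Fin 2) ℂ, Rᴴ * B * R = diagonal fun c => (m c : ℂ) := by
  have hspec : (hB.eigenvectorUnitary : Matrix (Fin 2) (Fin 2) ℂ)ᴴ * B * hB.eigenvectorUnitary =
      diagonal fun c => (hB.eigenvalues c : ℂ) :=
    by simpa [Unitary.conjStarAlgAut_apply, star_eq_conjTranspose, Function.comp_def] using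
      hB.conjStarAlgAut_star_eigenvectorUnitary
  rw [hB.trace_eq_sum_eigenvalues, Fin.sum_univ_two] at htr
  rw [hB.det_eq_prod_eigenvalues, Fin.prod_univ_two] at hdet
  generalize hB.eigenvalues = μ at *
  replace htr : μ 0 + μ 1 = m 0 + m 1 := Complex.ofReal_injective (by simpa using htr)
  replace hdet : μ 0 * μ 1 = m 0 * m 1 := Complex.ofReal_injective (by simpa using hdet)
  have hcases : (μ 0 - m 0) * (μ 0 - m 1) = 0 := by
    linear_combination μ 0 * htr - hdet
  rcases mul_eq_zero.mp hcases with h | h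
  · refine ⟨_, hB.eigenvectorUnitary.2, hspec.trans ?_⟩
    congr 1
    funext c
    fin_cases c
    · exact_mod_cast sub_eq_zero.mp h
    · exact_mod_cast (by linarith : μ 1 = m 1)
  -- The eigenvalues occur in the other order, which the column swap corrects.
  · have hS : (!![0, 1; 1, 0] : Matrix (Fin 2) (Fin 2) ℂ) ∈ Matrix.unitaryGroup (Fin 2) ℂ := by
      rw [mem_unitaryGroup_iff]
      ext i k
      fin_cases i <;> fin_cases k <;> simp [mul_apply]
    refine ⟨_, mul_mem hB.eigenvectorUnitary.2 hS, ?_⟩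
    rw [conjTranspose_mul, Matrix.mul_assoc, ← Matrix.mul_assoc B, Matrix.mul_assoc _ _ᴴ,
      ← Matrix.mul_assoc _ᴴ (B * _), ← Matrix.mul_assoc _ᴴ B, hspec]
    have h0 : (μ 0 : ℂ) = m 1 := by exact_mod_cast sub_eq_zero.mp h
    have h1 : (μ 1 : ℂ) = m 0 := by exact_mod_cast (by linarith : μ 1 = m 0)
    ext i k
    fin_cases i <;> fin_cases k <;> simp [mul_apply, diagonal, h0, h1]

/-- The frame obtained by adding the rows `r j`, twisting the columns by `θ j` before and
applying `R j` after each addition. -/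
noncomputable def tower (n : ℕ) (r : ℕ → Fin 2 → ℝ) (R : ℕ → Matrix (Fin 2) (Fin 2) ℂ)
    (θ : ℕ → Fin 2 → ℂ) : ℕ → Matrix (Fin n) (Fin 2) ℂ
  | 0 => 0
  | j + 1 => (tower n r R θ j * diagonal (θ j) + rowAt n j fun c => (r j c : ℂ)) * R j

variable {m r : ℕ → Fin 2 → ℝ} {R : ℕ → Matrix (Fin 2) (Fin 2) ℂ} {θ θ' : ℕ → Fin 2 → ℂ}

theorem firstRows_tower (j : ℕ) : firstRows (tower n r R θ j) j = tower n r R θ j := by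
  induction j with
  | zero => exact firstRows_zero _
  | succ j ih =>
    rw [tower, firstRows_mul, firstRows_add_rowAt_succ (by rw [firstRows_mul, ih])]

theorem tower_congr {j : ℕ} (h : ∀ i < j, θ i = θ' i) : tower n r R θ j = tower n r R θ' j := by
  induction j with
  | zero => rfl
  | succ j ih => rw [tower, tower, ih fun i hi => h i (by omega), h j (by omega)]

theorem continuous_tower (j : ℕ) : Continuous fun θ => tower n r R θ j := by
  induction j with
  | zero => exact continuous_const
  | succ j ih =>
    simp only [tower]
    have h : Continuous fun θ : ℕ → Fin 2 → ℂ => diagonal (θ j) :=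
      (continuous_apply j).matrix_diagonal
    exact ((ih.matrix_mul h).add continuous_const).matrix_mul continuous_const

theorem conjTranspose_diagonal_mul_diagonal {d : Fin 2 → ℂ} (hd : ∀ c, ‖d c‖ = 1)
    (a : Fin 2 → ℂ) : (diagonal d)ᴴ * diagonal a * diagonal d = diagonal a := by
  rw [diagonal_conjTranspose, diagonal_mul_diagonal, diagonal_mul_diagonal]
  congr 1
  funext c
  have h := star_mul_self_eq (d c)
  rw [hd c] at h
  rw [Pi.star_apply, mul_right_comm, h]
  simp

theorem diagonal_mem_unitaryGroup {d : Fin 2 → ℂ} (hd : ∀ c, ‖d c‖ = 1) :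
    diagonal d ∈ Matrix.unitaryGroup (Fin 2) ℂ := by
  rw [mem_unitaryGroup_iff', star_eq_conjTranspose]
  have h := conjTranspose_diagonal_mul_diagonal hd 1
  simpa using h

/-- The rotations `R` diagonalize the Gram matrices after each added row, and up to a rotation
the absolute values of the entries of the new row are determined by its Gram matrix. -/
structure IsTowerData (n : ℕ) (m r : ℕ → Fin 2 → ℝ) (R : ℕ → Matrix (Fin 2) (Fin 2) ℂ) :
    Prop where
  zero : m 0 = 0
  unitary : ∀ j, R j ∈ Matrix.unitaryGroup (Fin 2) ℂ
  step : ∀ j < n, (R j)ᴴ * ((diagonal fun c => (m j c : ℂ)) +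
    vecMulVec (star fun c => (r j c : ℂ)) fun c => (r j c : ℂ)) * R j =
      diagonal fun c => (m (j + 1) c : ℂ)
  align : ∀ j < n, ∀ v : Fin 2 → ℂ,
    ((diagonal fun c => (m j c : ℂ)) + vecMulVec (star v) v).trace =
      (m (j + 1) 0 : ℂ) + m (j + 1) 1 →
    ((diagonal fun c => (m j c : ℂ)) + vecMulVec (star v) v).det =
      (m (j + 1) 0 : ℂ) * m (j + 1) 1 →
    ∃ W ∈ Matrix.unitaryGroup (Fin 2) ℂ, (j = 0 ∨ W = 1) ∧ ∀ c, ‖(v ᵥ* W) c‖ = r j c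

namespace IsTowerData

/-- Column phases commute with a diagonal Gram matrix and cancel, so they leave the spectrum
unchanged. -/
theorem gram_tower (h : IsTowerData n m r R) (hθ : ∀ j c, ‖θ j c‖ = 1) {j : ℕ} (hj : j ≤ n) :
    (tower n r R θ j)ᴴ * tower n r R θ j = diagonal fun c => (m j c : ℂ) := by
  induction j with
  | zero => simp [tower, h.zero]
  | succ j ih =>
    have hf : firstRows (tower n r R θ j * diagonal (θ j)) j = tower n r R θ j * diagonal (θ j) := by
      rw [firstRows_mul, firstRows_tower]
    rw [tower, conjTranspose_mul, ← h.step j hj, Matrix.mul_assoc, ← Matrix.mul_assoc _ _ (R j),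
      gram_add_rowAt hj hf, conjTranspose_mul, Matrix.mul_assoc (diagonal (θ j))ᴴ,
      ← Matrix.mul_assoc _ _ (diagonal (θ j)), ih (by omega), ← Matrix.mul_assoc (diagonal (θ j))ᴴ,
      conjTranspose_diagonal_mul_diagonal (hθ j), Matrix.mul_assoc]

/-- Later steps act on the earlier rows only by unitary matrices on the right. -/
theorem exists_firstRows_tower (h : IsTowerData n m r R) (hθ : ∀ j c, ‖θ j c‖ = 1) {j k : ℕ}
    (hjk : j ≤ k) :
    ∃ W ∈ Matrix.unitaryGroup (Fin 2) ℂ, firstRows (tower n r R θ k) j = tower n r R θ j * W := by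
  induction k, hjk using Nat.le_induction with
  | base => exact ⟨1, one_mem _, by rw [firstRows_tower, Matrix.mul_one]⟩
  | succ k hk ih =>
    obtain ⟨W, hW, e⟩ := ih
    refine ⟨W * diagonal (θ k) * R k,
      mul_mem (mul_mem hW (diagonal_mem_unitaryGroup (hθ k))) (h.unitary k), ?_⟩
    rw [tower, firstRows_mul, firstRows_add, firstRows_mul, e, firstRows_rowAt hk, add_zero]
    simp only [Matrix.mul_assoc]

theorem frameGram_tower (h : IsTowerData n m r R) (hθ : ∀ j c, ‖θ j c‖ = 1) {j : ℕ}
    (hj : j ≤ n) :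
    (frameGram (tower n r R θ n) j).trace = (m j 0 : ℂ) + m j 1 ∧
      (frameGram (tower n r R θ n) j).det = (m j 0 : ℂ) * m j 1 := by
  obtain ⟨W, hW, e⟩ := h.exists_firstRows_tower hθ hj
  have hW' : W * Wᴴ = 1 := (mem_unitaryGroup_iff).mp hW
  have hG : frameGram (tower n r R θ n) j = Wᴴ * ((diagonal fun c => (m j c : ℂ)) * W) := by
    rw [frameGram, e, conjTranspose_mul, Matrix.mul_assoc, ← Matrix.mul_assoc _ _ W,
      h.gram_tower hθ hj]
  rw [hG, trace_mul_comm, det_mul_comm, Matrix.mul_assoc, hW', Matrix.mul_one]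
  simp

/-- The phase `θ j c` can be read off from the frame. -/
def IsFree (n : ℕ) (m r : ℕ → Fin 2 → ℝ) (j : ℕ) (c : Fin 2) : Prop :=
  j < n ∧ m j c ≠ 0 ∧ r j c ≠ 0

theorem tower_mul_conjTranspose (h : IsTowerData n m r R) (hθ : ∀ j c, ‖θ j c‖ = 1) {j : ℕ}
    (hj : j ≤ n) (i k : Fin n) :
    (tower n r R θ j * (tower n r R θ j)ᴴ) i k =
      if (i : ℕ) < j ∧ (k : ℕ) < j then (tower n r R θ n * (tower n r R θ n)ᴴ) i k else 0 := by
  obtain ⟨W, hW, e⟩ := h.exists_firstRows_tower hθ hj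
  have hW' : W * Wᴴ = 1 := (mem_unitaryGroup_iff).mp hW
  have he : tower n r R θ j * (tower n r R θ j)ᴴ =
      firstRows (tower n r R θ n) j * (firstRows (tower n r R θ n) j)ᴴ := by
    rw [e, conjTranspose_mul, Matrix.mul_assoc, ← Matrix.mul_assoc W, hW', Matrix.one_mul]
  rw [he]
  simp only [mul_apply, conjTranspose_apply, firstRows, of_apply]
  by_cases h1 : (i : ℕ) < j <;> by_cases h2 : (k : ℕ) < j <;> simp [h1, h2]

/-- Induct on `j`. The entries of `x` in column `j` above the diagonal are the tower applied to the
phases times `r j`. Multiplying by the adjoint of the tower recovers each phase for which `m j c`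
and `r j c` are nonzero. -/
theorem phase_injective (h : IsTowerData n m r R) (hθ : ∀ j c, ‖θ j c‖ = 1)
    (hθ' : ∀ j c, ‖θ' j c‖ = 1) (hfree : ∀ j c, ¬ IsFree n m r j c → θ j c = θ' j c)
    (heq : tower n r R θ n * (tower n r R θ n)ᴴ = tower n r R θ' n * (tower n r R θ' n)ᴴ) :
    θ = θ' := by
  have hsq : ∀ j ≤ n, tower n r R θ j * (tower n r R θ j)ᴴ =
      tower n r R θ' j * (tower n r R θ' j)ᴴ := by
    intro j hj
    ext i k
    rw [h.tower_mul_conjTranspose hθ hj, h.tower_mul_conjTranspose hθ' hj, heq]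
  have key : ∀ j, θ j = θ' j := by
    intro j
    induction j using Nat.strong_induction_on with
    | _ j ih =>
      by_cases hj : j < n
      swap
      · funext c
        exact hfree j c fun hf => hj hf.1
      have ht := tower_congr (n := n) (r := r) (R := R) (fun i hi => ih i hi)
      have hx := hsq (j + 1) hj
      have hR : R j * (R j)ᴴ = 1 := (mem_unitaryGroup_iff).mp (h.unitary j)
      simp only [tower, ← ht, conjTranspose_mul] at hx
      rw [Matrix.mul_assoc, ← Matrix.mul_assoc (R j), hR, Matrix.one_mul, Matrix.mul_assoc,
        ← Matrix.mul_assoc (R j), hR, Matrix.one_mul] at hx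
      have hz : tower n r R θ j *ᵥ (fun c => (θ j c - θ' j c) * (r j c : ℂ)) = 0 := by
        funext i
        by_cases hi : (i : ℕ) < j
        · have hij := congrFun (congrFun hx i) ⟨j, hj⟩
          have hz0 : ∀ c, tower n r R θ j ⟨j, hj⟩ c = 0 := fun c =>
            firstRows_apply_eq_zero (firstRows_tower j) (i := ⟨j, hj⟩) le_rfl c
          simp only [mul_apply, conjTranspose_apply, Matrix.add_apply, rowAt, of_apply,
            if_neg hi.ne, if_true, hz0, zero_mul, zero_add, add_zero,
            Fin.sum_univ_two, Complex.star_def, Complex.conj_ofReal] at hij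
          simp only [mulVec, dotProduct, Fin.sum_univ_two, Pi.zero_apply]
          simp [diagonal] at hij
          linear_combination hij
        · simp [mulVec, dotProduct,
            firstRows_apply_eq_zero (firstRows_tower (n := n) (r := r) (R := R) (θ := θ) j)
              (not_lt.mp hi)]
      have hz' := congrArg ((tower n r R θ j)ᴴ *ᵥ ·) hz
      simp only [mulVec_mulVec, h.gram_tower hθ hj.le, mulVec_zero] at hz'
      funext c
      by_cases hf : IsFree n m r j c
      · have hc := congrFun hz' c
        rw [mulVec_diagonal] at hc
        simp only [Pi.zero_apply, mul_eq_zero, Complex.ofReal_eq_zero, hf.2.1, hf.2.2, false_or,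
          or_false] at hc
        exact sub_eq_zero.mp hc
      · exact hfree j c hf
  exact funext key

theorem exists_phase {z : ℂ} {ρ : ℝ} (hz : ‖z‖ = ρ) :
    ∃ d : ℂ, ‖d‖ = 1 ∧ z * d = ρ ∧ (ρ = 0 → d = 1) := by
  by_cases h0 : ρ = 0
  · refine ⟨1, by simp, ?_, fun _ => rfl⟩
    rw [h0, norm_eq_zero] at hz
    simp [hz, h0]
  · have hz0 : z ≠ 0 := by
      rintro rfl
      exact h0 (by simpa using hz.symm)
    have hρ : (ρ : ℂ) ≠ 0 := by exact_mod_cast h0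
    refine ⟨ρ / z, ?_, mul_div_cancel₀ _ hz0, fun h => absurd h h0⟩
    rw [norm_div, hz, Complex.norm_real, ← hz, norm_norm, div_self (norm_ne_zero_iff.mpr hz0)]

/-- Once rotated into the basis of the tower, the next row has moduli `r j`; a diagonal unitary
makes it real and becomes the next pair of phases. -/
theorem exists_phases (h : IsTowerData n m r R) {A : Matrix (Fin n) (Fin 2) ℂ}
    (hA : ∀ j ≤ n, (frameGram A j).trace = (m j 0 : ℂ) + m j 1 ∧
      (frameGram A j).det = (m j 0 : ℂ) * m j 1) {j : ℕ} (hj : j ≤ n) :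
    ∃ θ : ℕ → Fin 2 → ℂ, (∀ j c, ‖θ j c‖ = 1) ∧ (∀ j c, ¬ IsFree n m r j c → θ j c = 1) ∧
      ∃ V ∈ Matrix.unitaryGroup (Fin 2) ℂ, firstRows A j * V = tower n r R θ j := by
  classical
  induction j with
  | zero =>
    exact ⟨1, by simp, by simp, 1, one_mem _, by simp [firstRows_zero, tower]⟩
  | succ j ih =>
    obtain ⟨θ, hθ, hfree, V, hV, e⟩ := ih (by omega)
    have hV' : V * Vᴴ = 1 := (mem_unitaryGroup_iff).mp hV
    set T := tower n r R θ j with hT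
    have hTf : firstRows T j = T := firstRows_tower j
    have hgram : Vᴴ * (frameGram A (j + 1) * V) = (diagonal fun c => (m j c : ℂ)) +
        vecMulVec (star (A ⟨j, hj⟩ ᵥ* V)) (A ⟨j, hj⟩ ᵥ* V) := by
      rw [← h.gram_tower hθ (by omega : j ≤ n), ← hT, ← gram_add_rowAt hj hTf, ← e, ← rowAt_mul,
        ← Matrix.add_mul, ← firstRows_succ, conjTranspose_mul, frameGram]
      simp only [Matrix.mul_assoc]
    obtain ⟨W, hW, hW1, hWr⟩ := h.align j hj (A ⟨j, hj⟩ ᵥ* V)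
      (by rw [← hgram, trace_mul_comm, Matrix.mul_assoc, hV', Matrix.mul_one]
          exact (hA (j + 1) hj).1)
      (by rw [← hgram, det_mul_comm, Matrix.mul_assoc, hV', Matrix.mul_one]
          exact (hA (j + 1) hj).2)
    -- A nontrivial alignment is allowed only at `j = 0`, where the tower is still zero.
    have hTW : T * W = T := by
      rcases hW1 with h0 | h1
      · rw [hT]
        subst h0
        simp [tower]
      · rw [h1, Matrix.mul_one]
    choose d hd1 hd2 hd3 using fun c => exists_phase (hWr c)
    let δ : Fin 2 → ℂ := fun c => if IsFree n m r j c then d c else 1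
    -- Resetting a non-free phase to `1` changes nothing: either the column of `T` is zero, or the
    -- row entry is zero and the chosen phase was already `1`.
    have hδ : T * diagonal d = T * diagonal δ := by
      ext i c
      rw [mul_diagonal, mul_diagonal]
      by_cases hf : IsFree n m r j c
      · simp [δ, hf]
      · by_cases hr : r j c = 0
        · simp [δ, hf, hd3 c hr]
        · have hm : m j c = 0 := by
            by_contra hm
            exact hf ⟨hj, hm, hr⟩
          have hcol : T i c = 0 := by
            have hg := congrFun (congrFun (h.gram_tower hθ (by omega : j ≤ n)) c) c
            rw [mul_apply, diagonal_apply_eq, hm] at hg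
            simp only [conjTranspose_apply, star_mul_self_eq] at hg
            have hg' : ∑ i, ‖T i c‖ ^ 2 = 0 := by exact_mod_cast hg
            rw [Finset.sum_eq_zero_iff_of_nonneg fun i _ => by positivity] at hg'
            simpa using hg' i (Finset.mem_univ i)
          simp [hcol]
    refine ⟨Function.update θ j δ, ?_, ?_, V * W * diagonal d * R j,
      mul_mem (mul_mem (mul_mem hV hW) (diagonal_mem_unitaryGroup hd1)) (h.unitary j), ?_⟩
    · intro k c
      by_cases hk : k = j
      · subst hk
        simp only [Function.update_self, δ]
        split_ifs
        · exact hd1 c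
        · simp
      · rw [Function.update_of_ne hk]
        exact hθ k c
    · intro k c hf
      by_cases hk : k = j
      · subst hk
        simp [Function.update_self, δ, hf]
      · rw [Function.update_of_ne hk]
        exact hfree k c hf
    · have hT' : tower n r R (Function.update θ j δ) j = T :=
        tower_congr fun i hi => Function.update_of_ne hi.ne _ _
      have hrow : (A ⟨j, hj⟩ ᵥ* V) ᵥ* W ᵥ* diagonal d = fun c => (r j c : ℂ) := by
        funext c
        rw [vecMul_diagonal, hd2 c]
      rw [tower, hT', Function.update_self, ← hδ, ← hrow, firstRows_succ A hj,
        ← Matrix.mul_assoc, Matrix.mul_assoc V, ← Matrix.mul_assoc _ V, Matrix.add_mul, e,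
        rowAt_mul, ← Matrix.mul_assoc, Matrix.add_mul T, hTW, rowAt_mul, Matrix.add_mul T,
        rowAt_mul]

end IsTowerData

end Tower

/-! ### Generic fibers are tori -/

section Torus

open Matrix

theorem trace_diagonal_add_vecMulVec (m : Fin 2 → ℝ) (v : Fin 2 → ℂ) :
    ((diagonal fun c => (m c : ℂ)) + vecMulVec (star v) v).trace =
      ((m 0 + m 1 + (‖v 0‖ ^ 2 + ‖v 1‖ ^ 2) : ℝ) : ℂ) := by
  simp only [trace_add, trace_fin_two, diagonal_apply_eq, vecMulVec_apply, Pi.star_apply,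
    star_mul_self_eq]
  push_cast
  ring

theorem det_diagonal_add_vecMulVec (m : Fin 2 → ℝ) (v : Fin 2 → ℂ) :
    ((diagonal fun c => (m c : ℂ)) + vecMulVec (star v) v).det =
      ((m 0 * m 1 + (m 0 * ‖v 1‖ ^ 2 + m 1 * ‖v 0‖ ^ 2) : ℝ) : ℂ) := by
  have h0 := star_mul_self_eq (v 0)
  have h1 := star_mul_self_eq (v 1)
  rw [det_fin_two]
  simp only [Matrix.add_apply, diagonal_apply_eq, vecMulVec_apply, Pi.star_apply,
    diagonal_apply_ne _ (zero_ne_one : (0 : Fin 2) ≠ 1),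
    diagonal_apply_ne _ (one_ne_zero : (1 : Fin 2) ≠ 0), h0, h1]
  push_cast at h0 h1 ⊢
  linear_combination -(star (v 1) * v 1) * h0 - (‖v 0‖ : ℂ) ^ 2 * h1

theorem isHermitian_diagonal_add_vecMulVec (m : Fin 2 → ℝ) (v : Fin 2 → ℂ) :
    ((diagonal fun c => (m c : ℂ)) + vecMulVec (star v) v).IsHermitian := by
  refine IsHermitian.add ?_ ?_
  · rw [isHermitian_diagonal_iff]
    intro c
    simp [isSelfAdjoint_iff]
  · ext a b
    simp [vecMulVec_apply, mul_comm]

/-- A new row with prescribed change of the spectrum of the Gram matrix exists, and the absolute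
values of its entries are unique. -/
theorem exists_row {a b a' b' : ℝ} (hab : b < a) (ha : a ≤ a') (hb : b ≤ b') (hb' : b' ≤ a) :
    ∃ ρ₀ ρ₁ : ℝ, (0 ≤ ρ₀ ∧ 0 ≤ ρ₁) ∧
      ∀ x y : ℝ, 0 ≤ x → 0 ≤ y →
        (a + b + (x ^ 2 + y ^ 2) = a' + b' ∧ a * b + (a * y ^ 2 + b * x ^ 2) = a' * b' ↔
          x = ρ₀ ∧ y = ρ₁) := by
  have hd : a - b ≠ 0 := by linarith
  have h0 : 0 ≤ (a' - a) * (a - b') / (a - b) :=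
    div_nonneg (mul_nonneg (by linarith) (by linarith)) (by linarith)
  have h1 : 0 ≤ (a' - b) * (b' - b) / (a - b) :=
    div_nonneg (mul_nonneg (by linarith) (by linarith)) (by linarith)
  -- Trace and determinant are linear in `x ^ 2`, `y ^ 2` with determinant of absolute value `a -
  -- b`. These are the roots of the solution, nonnegative by interlacing.
  refine ⟨√((a' - a) * (a - b') / (a - b)), √((a' - b) * (b' - b) / (a - b)),
    ⟨Real.sqrt_nonneg _, Real.sqrt_nonneg _⟩, fun x y hx hy => ?_⟩
  rw [eq_comm (a := x), eq_comm (a := y), Real.sqrt_eq_iff_eq_sq h0 hx,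
    Real.sqrt_eq_iff_eq_sq h1 hy, div_eq_iff hd, div_eq_iff hd]
  constructor
  · rintro ⟨e1, e2⟩
    exact ⟨by linear_combination e2 - a * e1, by linear_combination b * e1 - e2⟩
  · rintro ⟨e1, e2⟩
    constructor
    · apply mul_left_cancel₀ hd
      linear_combination -e1 - e2
    · apply mul_left_cancel₀ hd
      linear_combination -b * e1 - a * e2

variable {n : ℕ} {t : ℝ} {u : Index n → ℝ}

/-- The two possibly nonzero eigenvalues of the leading `j × j` submatrix. -/
noncomputable def topTwo (u : Index n → ℝ) (j : ℕ) : Fin 2 → ℝ := ![top u j, second u j]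

theorem topTwo_zero (u : Index n → ℝ) : topTwo u 0 = 0 := by
  ext c
  fin_cases c <;> simp [topTwo, top_zero, second_zero]

theorem exists_towerData_step (ht : 0 < t) (hu : u ∈ gcPolytope (grassmannPattern 2 n t))
    (hlt : ∀ j, 1 ≤ j → j < n → second u j < top u j) (j : ℕ) :
    ∃ (r : Fin 2 → ℝ) (R : Matrix (Fin 2) (Fin 2) ℂ), R ∈ Matrix.unitaryGroup (Fin 2) ℂ ∧
      (j < n → Rᴴ * ((diagonal fun c => (topTwo u j c : ℂ)) +
        vecMulVec (star fun c => (r c : ℂ)) fun c => (r c : ℂ)) * R =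
          diagonal (fun c => (topTwo u (j + 1) c : ℂ)) ∧
        ∀ v : Fin 2 → ℂ,
          ((diagonal fun c => (topTwo u j c : ℂ)) + vecMulVec (star v) v).trace =
            (topTwo u (j + 1) 0 : ℂ) + topTwo u (j + 1) 1 →
          ((diagonal fun c => (topTwo u j c : ℂ)) + vecMulVec (star v) v).det =
            (topTwo u (j + 1) 0 : ℂ) * topTwo u (j + 1) 1 →
          ∃ W ∈ Matrix.unitaryGroup (Fin 2) ℂ, (j = 0 ∨ W = 1) ∧ ∀ c, ‖(v ᵥ* W) c‖ = r c) := by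
  by_cases hj : j < n
  swap
  · exact ⟨0, 1, one_mem _, fun h => absurd h hj⟩
  by_cases hj0 : j = 0
  · subst hj0
    have hm1 : topTwo u (0 + 1) 1 = 0 := second_one u
    have hm0 : 0 ≤ topTwo u (0 + 1) 0 := top_nonneg ht hu 1
    -- At the start both eigenvalues are zero and `exists_row` does not apply; instead the first row
    -- is rotated onto the first axis.
    refine ⟨![√(topTwo u (0 + 1) 0), 0], 1, one_mem _, fun _ => ⟨?_, fun v htr hdet => ?_⟩⟩
    · rw [topTwo_zero]
      have hs : ((√(topTwo u (0 + 1) 0) : ℝ) : ℂ) * ((√(topTwo u (0 + 1) 0) : ℝ) : ℂ) =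
          (topTwo u (0 + 1) 0 : ℂ) := by
        rw [← Complex.ofReal_mul, Real.mul_self_sqrt hm0]
      ext a b
      fin_cases a <;> fin_cases b <;> simp [vecMulVec_apply, diagonal, hs, -zero_add, hm1]
    · obtain ⟨W, hW, e⟩ := exists_unitary_diagonalizing
        (isHermitian_diagonal_add_vecMulVec _ v) htr hdet
      refine ⟨W, hW, Or.inl rfl, fun c => ?_⟩
      have e' : Wᴴ * ((diagonal fun c => (topTwo u 0 c : ℂ)) + vecMulVec (star v) v) * W =
          vecMulVec (star (v ᵥ* W)) (v ᵥ* W) := by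
        rw [topTwo_zero, star_vecMul, ← Matrix.vecMulVec_mul, ← Matrix.mul_vecMulVec]
        simp
      have hc := congrFun (congrFun (e'.symm.trans e) c) c
      rw [vecMulVec_apply, Pi.star_apply, star_mul_self_eq, diagonal_apply_eq,
        Complex.ofReal_inj] at hc
      rw [← sq_eq_sq₀ (norm_nonneg _) (by fin_cases c <;> simp), hc]
      fin_cases c
      · simp [Real.sq_sqrt, hm0, -zero_add]
      · simp [hm1, -zero_add]
  · obtain ⟨ρ₀, ρ₁, ⟨h0, h1⟩, hρ⟩ := exists_row (hlt j (by omega) hj) (top_mono ht hu hj)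
      (second_mono ht hu hj) (second_succ_le_top hu hj)
    obtain ⟨e1, e2⟩ := (hρ ρ₀ ρ₁ h0 h1).mpr ⟨rfl, rfl⟩
    obtain ⟨R, hR, e⟩ := exists_unitary_diagonalizing (m := topTwo u (j + 1))
      (isHermitian_diagonal_add_vecMulVec (topTwo u j) fun c => ((![ρ₀, ρ₁] c : ℝ) : ℂ))
      (by
        rw [trace_diagonal_add_vecMulVec, ← Complex.ofReal_add]
        simpa [topTwo, sq_abs] using congrArg Complex.ofReal e1)
      (by
        rw [det_diagonal_add_vecMulVec, ← Complex.ofReal_mul]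
        simpa [topTwo, sq_abs] using congrArg Complex.ofReal e2)
    refine ⟨![ρ₀, ρ₁], R, hR, fun _ => ⟨e, fun v htr hdet => ⟨1, one_mem _, Or.inr rfl, ?_⟩⟩⟩
    rw [trace_diagonal_add_vecMulVec, ← Complex.ofReal_add, Complex.ofReal_inj] at htr
    rw [det_diagonal_add_vecMulVec, ← Complex.ofReal_mul, Complex.ofReal_inj] at hdet
    obtain ⟨a0, a1⟩ := (hρ ‖v 0‖ ‖v 1‖ (norm_nonneg _) (norm_nonneg _)).mp ⟨htr, hdet⟩
    rw [vecMul_one]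
    intro c
    fin_cases c
    · exact a0
    · exact a1

theorem exists_isTowerData (ht : 0 < t) (hu : u ∈ gcPolytope (grassmannPattern 2 n t))
    (hlt : ∀ j, 1 ≤ j → j < n → second u j < top u j) :
    ∃ r R, IsTowerData n (topTwo u) r R := by
  choose r R hR h using exists_towerData_step ht hu hlt
  exact ⟨r, R, topTwo_zero u, hR, fun j hj => (h j hj).1, fun j hj => (h j hj).2⟩

/-- The phases that are not free are put equal to `1`. -/
noncomputable def extendPhases {m r : ℕ → Fin 2 → ℝ}
    (φ : {q : Fin n × Fin 2 // IsTowerData.IsFree n m r q.1 q.2} → Circle) (j : ℕ) (c : Fin 2) :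
    ℂ :=
  open Classical in
  if h : IsTowerData.IsFree n m r j c then Circle.coeHom (φ ⟨(⟨j, h.1⟩, c), h⟩) else 1

theorem isTorus_of_continuous_bijective {α ι : Type*} [TopologicalSpace α] [T2Space α]
    [Finite ι] {Y : Set α} {f : (ι → Circle) → Y} (hf : Continuous f)
    (hbij : Function.Bijective f) : IsTorus Y := by
  have := Fintype.ofFinite ι
  let e : (ι → Circle) ≃ₜ Y := Continuous.homeoOfEquivCompactToT2 (f := Equiv.ofBijective f hbij) hf
  exact ⟨Fintype.card ι, ⟨e.symm.trans
    (Homeomorph.piCongrLeft (Y := fun _ => Circle) (Fintype.equivFin ι))⟩⟩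

/-- The free phases parametrize the fiber: `phase_injective` gives injectivity, `exists_phases`
surjectivity, and compactness makes the continuous bijection a homeomorphism. -/
theorem isTorus_gcFiber (hn : 2 ≤ n) (ht : 0 < t)
    (hu : u ∈ gcPolytope (grassmannPattern 2 n t))
    (hlt : ∀ j, 1 ≤ j → j < n → second u j < top u j) :
    IsTorus (gcFiber (grassmannPattern 2 n t) u) := by
  have : NeZero n := ⟨by omega⟩
  obtain ⟨r, R, h⟩ := exists_isTowerData ht hu hlt
  let P := {q : Fin n × Fin 2 // IsTowerData.IsFree n (topTwo u) r q.1 q.2}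
  let θ : (P → Circle) → ℕ → Fin 2 → ℂ := extendPhases
  have hθ : ∀ φ j c, ‖θ φ j c‖ = 1 := by
    intro φ j c
    simp only [θ, extendPhases]
    split_ifs
    · exact Circle.norm_coe _
    · exact norm_one
  have hfree : ∀ φ j c, ¬ IsTowerData.IsFree n (topTwo u) r j c → θ φ j c = 1 := by
    intro φ j c hf
    simp [θ, extendPhases, hf]
  have hθc : Continuous θ := by
    refine continuous_pi fun j => continuous_pi fun c => ?_
    simp only [θ, extendPhases]
    split_ifs with hf
    · exact continuous_subtype_val.comp (continuous_apply _)
    · exact continuous_const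
  have horbit : ∀ φ, tower n r R (θ φ) n * (tower n r R (θ φ) n)ᴴ ∈
      orbit (grassmannPattern 2 n t) := by
    intro φ
    refine mem_orbit_of_frame hn ht ?_
    rw [h.gram_tower (hθ φ) le_rfl]
    ext a b
    fin_cases a <;> fin_cases b <;>
      simp [topTwo, diagonal, top_eq_of_le hn ht hu (j := n) (by omega) le_rfl,
        second_self hn hu]
  have hfiber : ∀ φ, (⟨_, horbit φ⟩ : orbit (grassmannPattern 2 n t)) ∈
      gcFiber (grassmannPattern 2 n t) u := fun φ =>
    (gcMap_eq_iff_gram ht hu _ rfl).mpr fun j _ hj => h.frameGram_tower (hθ φ) hj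
  refine isTorus_of_continuous_bijective (f := fun φ => ⟨⟨_, horbit φ⟩, hfiber φ⟩) ?_ ⟨?_, ?_⟩
  · have hT : Continuous fun φ => tower n r R (θ φ) n := (continuous_tower n).comp hθc
    exact ((hT.matrix_mul hT.matrix_conjTranspose).subtype_mk _).subtype_mk _
  · intro φ φ' heq
    have heq' := congrArg
      (fun x : gcFiber (grassmannPattern 2 n t) u => ((x : orbit (grassmannPattern 2 n t)) : Mat n)) heq
    have hphase := h.phase_injective (hθ φ) (hθ φ')
      (fun j c hf => (hfree φ j c hf).trans (hfree φ' j c hf).symm) heq'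
    funext ⟨⟨j, c⟩, hf⟩
    have hjc := congrFun (congrFun hphase j) c
    simp only [θ, extendPhases, dif_pos hf] at hjc
    exact Circle.ext hjc
  · rintro ⟨x, hx⟩
    obtain ⟨A, hA, hxA⟩ := exists_frame hn ht x
    obtain ⟨ψ, hψ, hψfree, V, hV, e⟩ := h.exists_phases (A := A) (fun j hj =>
      frameGram_of_gcMap_eq ht hu hxA hx hj) le_rfl
    refine ⟨fun q => ⟨ψ q.1.1 q.1.2, mem_sphere_zero_iff_norm.mpr (hψ _ _)⟩, ?_⟩
    have hext : θ (fun q => ⟨ψ q.1.1 q.1.2, mem_sphere_zero_iff_norm.mpr (hψ _ _)⟩) = ψ := by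
      funext j c
      simp only [θ, extendPhases]
      split_ifs with hf
      · rfl
      · exact (hψfree j c hf).symm
    have hV' : V * Vᴴ = 1 := (mem_unitaryGroup_iff).mp hV
    apply Subtype.ext
    apply Subtype.ext
    simp only [hext]
    rw [← e, firstRows_self, hxA, conjTranspose_mul, Matrix.mul_assoc, ← Matrix.mul_assoc V, hV',
      Matrix.one_mul]

end Torus

theorem theoremE (p : ℕ) (hp : p.Prime) (t : ℝ) (ht : 0 < t) :
    (∀ u ∈ gcPolytope (grassmannPattern 2 p t),
      IsLagrangian (gcFiber (grassmannPattern 2 p t) u) →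
      ¬ IsTorus (gcFiber (grassmannPattern 2 p t) u) →
      IsDisplaceable (gcFiber (grassmannPattern 2 p t) u)) ∧
    (∀ f : Set (Index p → ℝ),
      IsProperFace (grassmannPattern 2 p t) f →
      IsLagrangianFace (grassmannPattern 2 p t) f →
      IsDisplaceableFace (grassmannPattern 2 p t) f ∧
      ∃ w : Equiv.Perm (Fin p), PermDisplacesFace (grassmannPattern 2 p t) f w) ∧
    (∀ I : Finset ℕ, IsSquareSequence 2 p I →
      ∃ w : Equiv.Perm (Fin p),
        PermDisplacesFace (grassmannPattern 2 p t) (squareFace 2 p t I) w) := by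
  have : Fact p.Prime := ⟨hp⟩
  refine ⟨fun u hu _ htorus => ?_, fun f hf _ => ?_, fun I hI => ?_⟩
  · have hdeg : IsDegenerate u := by
      by_contra hd
      exact htorus (isTorus_gcFiber hp.two_le ht hu fun j h1 h2 =>
        second_lt_top_of_not_isDegenerate ht hu hd h1 h2)
    have hsub : {u} ⊆ gcPolytope (grassmannPattern 2 p t) := Set.singleton_subset_iff.mpr hu
    obtain ⟨w, hw⟩ := exists_permDisplacesFace ht hsub (by
      intro v hv
      rw [Set.mem_singleton_iff.mp (intrinsicInterior_subset hv)]
      exact hdeg)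
    exact isDisplaceable_of_permDisplacesFace ht hsub hw u (by simp)
  · have hsub : f ⊆ gcPolytope (grassmannPattern 2 p t) := hf.2.1.subset
    obtain ⟨w, hw⟩ := exists_permDisplacesFace ht hsub fun u hu =>
      isDegenerate_of_isProperFace hp.two_le ht hf (intrinsicInterior_subset hu)
    exact ⟨isDisplaceable_of_permDisplacesFace ht hsub hw, w, hw⟩
  · exact exists_permDisplacesFace ht (fun u hu => hu.1) fun u hu =>
      isDegenerate_of_mem_squareFace hI (intrinsicInterior_subset hu)
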